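/- Let $n\ge 0$, let $\mathbb{R}\{x\}$, $x=(x_1,\dots,x_n)$, be the ring of convergent real power series at $0\in\mathbb{R}^n$, and let $\hat f,\hat g\in\mathbb{R}\{x\}\setminus\{0\}$ be relatively prime (every common divisor is a unit). Let $\hat f=u\prod_{i=1}^{\alpha}\hat f_i^{\,n_i}$ and $\hat g=v\prod_{j=1}^{\beta}\hat g_j^{\,m_j}$ be decompositions into irreducible factors ($u,v$ units, the $\hat f_i$ and the $\hat g_j$ irreducible and pairwise non-associated within each product, $n_i,m_j\ge 1$), put $\hat f^{\rm red}=\prod_i\hat f_i$, $\hat g^{\rm red}=\prod_j\hat g_j$, and associate with $\hat\varphi=\hat f/\hat g$ the real analytic $1$-form \[\hat\theta_{\hat\varphi}=\hat f^{\rm red}\,\hat g^{\rm red}\left(\frac{d\hat f}{\hat f}-\frac{d\hat g}{\hat g}\right).\] The algebraic singular set ${\rm Sing}_{alg}(\hat\theta)$ of a real analytic $1$-form $\hat\theta=\sum_k\hat\theta_k\,dx_k$ is the greatest common divisor of its coefficients $\hat\theta_k$ in $\mathbb{R}\{x\}$ (defined up to a unit). For an integer $\ell\ge 1$, an irreducible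 $\hat h\in\mathbb{R}\{x\}$ is a component of multiplicity $\ell$ of ${\rm Sing}_{alg}(\hat\theta)$ if $\hat h^{\ell}$ divides this greatest common divisor but $\hat h^{\ell+1}$ does not. Let $\hat h\in\mathbb{R}\{x\}$ be irreducible and let $\ell\ge 1$ be an integer. Then $\hat h$ is a component of ${\rm Sing}_{alg}(\hat\theta_{\hat\varphi})$ of multiplicity $\ell$ if and only if $\ell$ is the largest non-negative integer for which at least one of the following conditions holds: \begin{enumerate} \item there exist $c\in\mathbb{R}\setminus\{0\}$ and $\hat s\in\mathbb{R}\{x\}$ such that $\hat f-c\,\hat g=\hat h^{\ell+1}\hat s$; \item there exist $c\in\mathbb{C}\setminus\mathbb{R}$ and $\hat\rho_1,\hat\rho_2,\hat\varsigma_1,\hat\varsigma_2\in\mathbb{R}\{x\}$ such that $\hat h=\pm(\hat\rho_1^2+\hat\rho_2^2)$ and \[\hat f^2+|c|^2\hat g^2-2\,{\rm Re}(c)\,\hat f\hat g=(\hat\rho_1^2+\hat\rho_2^2)^{\ell+1}(\hat\varsigma_1^2+\hat\varsigma_2^2).\] \end{enumerate} -/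

import Mathlib

/-- A formal power series in `n` variables is convergent if it converges absolutely on some
polydisc of positive radius around the origin. -/
def IsConvergentSeries {𝕜 : Type*} [NormedField 𝕜] {n : ℕ}
    (a : MvPowerSeries (Fin n) 𝕜) : Prop :=
  ∃ r : ℝ, 0 < r ∧
    Summable fun ν : Fin n →₀ ℕ => ‖MvPowerSeries.coeff ν a‖ * r ^ ν.degree

namespace IsConvergentSeries

variable {𝕜 : Type*} [NormedField 𝕜] {n : ℕ}

theorem mono {a : MvPowerSeries (Fin n) 𝕜} {r s : ℝ} (hs : 0 < s) (hsr : s ≤ r)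
    (h : Summable fun ν : Fin n →₀ ℕ => ‖MvPowerSeries.coeff ν a‖ * r ^ ν.degree) :
    Summable fun ν : Fin n →₀ ℕ => ‖MvPowerSeries.coeff ν a‖ * s ^ ν.degree := by
  refine Summable.of_nonneg_of_le (fun ν => by positivity) (fun ν => ?_) h
  gcongr

theorem add {a b : MvPowerSeries (Fin n) 𝕜} (ha : IsConvergentSeries a)
    (hb : IsConvergentSeries b) : IsConvergentSeries (a + b) := by
  obtain ⟨r, hr, ha⟩ := ha
  obtain ⟨s, hs, hb⟩ := hb
  have hm : 0 < min r s := lt_min hr hs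
  refine ⟨min r s, hm, Summable.of_nonneg_of_le (fun ν => by positivity) (fun ν => ?_)
    ((mono hm (min_le_left r s) ha).add (mono hm (min_le_right r s) hb))⟩
  rw [← add_mul, map_add]
  gcongr
  exact norm_add_le _ _

theorem mul {a b : MvPowerSeries (Fin n) 𝕜} (ha : IsConvergentSeries a)
    (hb : IsConvergentSeries b) : IsConvergentSeries (a * b) := by
  classical
  obtain ⟨r, hr, ha⟩ := ha
  obtain ⟨s, hs, hb⟩ := hb
  have hm : 0 < min r s := lt_min hr hs
  have key := summable_sum_mul_antidiagonal_of_summable_mul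
    (Summable.mul_of_nonneg (mono hm (min_le_left r s) ha) (mono hm (min_le_right r s) hb)
      (fun ν => by positivity) (fun ν => by positivity))
  refine ⟨min r s, hm, Summable.of_nonneg_of_le (fun ν => by positivity) (fun ν => ?_) key⟩
  rw [MvPowerSeries.coeff_mul]
  refine (mul_le_mul_of_nonneg_right (norm_sum_le _ _) (by positivity)).trans ?_
  rw [Finset.sum_mul]
  refine Finset.sum_le_sum fun p hp => ?_
  rw [← Finset.HasAntidiagonal.mem_antidiagonal.mp hp, norm_mul, map_add, pow_add]
  exact le_of_eq (by ring)

theorem algebraMap (c : 𝕜) :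
    IsConvergentSeries (algebraMap 𝕜 (MvPowerSeries (Fin n) 𝕜) c) := by
  classical
  refine ⟨1, one_pos, summable_of_ne_finset_zero (s := {0}) fun ν hν => ?_⟩
  have hν : ν ≠ 0 := by simpa using hν
  simp [MvPowerSeries.algebraMap_apply, MvPowerSeries.coeff_C, hν]

theorem pderiv {a : MvPowerSeries (Fin n) 𝕜} (ha : IsConvergentSeries a) (i : Fin n) :
    IsConvergentSeries (MvPowerSeries.pderiv 𝕜 i a) := by
  obtain ⟨r, hr, ha⟩ := ha
  have hinj : Function.Injective fun ν : Fin n →₀ ℕ => ν + Finsupp.single i 1 :=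
    add_left_injective _
  have h1 := (ha.comp_injective hinj).mul_left (2 / r)
  refine ⟨r / 2, by positivity, Summable.of_nonneg_of_le (fun ν => by positivity)
    (fun ν => ?_) h1⟩
  have hle : ν i ≤ ν.degree := Finsupp.le_degree i ν
  have h2 : ((ν i : ℝ) + 1) ≤ 2 * 2 ^ ν.degree := by
    have : ν i + 1 ≤ 2 * 2 ^ ν.degree := by
      have := Nat.lt_two_pow_self (n := ν.degree)
      omega
    exact_mod_cast this
  have h3 : ‖((ν i : 𝕜) + 1)‖ ≤ (ν i : ℝ) + 1 := by
    have := Nat.norm_cast_le (α := 𝕜) (ν i + 1)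
    simpa using this
  have hdeg : (ν + Finsupp.single i 1).degree = ν.degree + 1 := by
    rw [map_add, Finsupp.degree_single]
  simp only [Function.comp_apply]
  rw [MvPowerSeries.coeff_pderiv, norm_mul, hdeg]
  calc _ ≤ ‖MvPowerSeries.coeff (ν + Finsupp.single i 1) a‖ * (2 * 2 ^ ν.degree)
          * (r / 2) ^ ν.degree := by
        gcongr
        exact h3.trans h2
    _ = _ := by
        rw [div_pow, pow_succ]
        field_simp

end IsConvergentSeries

/-- The ring `𝕜{x}`, `x = (x₁, …, xₙ)`, of convergent power series. -/
def ConvergentSeries (𝕜 : Type*) [NormedField 𝕜] (n : ℕ) :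
    Subalgebra 𝕜 (MvPowerSeries (Fin n) 𝕜) where
  carrier := {a | IsConvergentSeries a}
  mul_mem' := IsConvergentSeries.mul
  add_mem' := IsConvergentSeries.add
  algebraMap_mem' := IsConvergentSeries.algebraMap

namespace ConvergentSeries

/-- The partial derivative `∂/∂xᵢ` on `𝕜{x}`. -/
noncomputable def pderiv {𝕜 : Type*} [NormedField 𝕜] {n : ℕ} (i : Fin n)
    (a : ConvergentSeries 𝕜 n) : ConvergentSeries 𝕜 n :=
  ⟨MvPowerSeries.pderiv 𝕜 i a.1, IsConvergentSeries.pderiv a.2 i⟩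

/-- An analytic `1`-form germ `∑ₖ ωₖ dxₖ`, given by its coefficients `ωₖ ∈ 𝕜{x}`. -/
abbrev OneForm (𝕜 : Type*) [NormedField 𝕜] (n : ℕ) : Type _ :=
  Fin n → ConvergentSeries 𝕜 n

/-- The exterior derivative `da = ∑ₖ (∂a/∂xₖ) dxₖ`. -/
noncomputable def d {𝕜 : Type*} [NormedField 𝕜] {n : ℕ} (a : ConvergentSeries 𝕜 n) :
    OneForm 𝕜 n :=
  fun k => pderiv k a

/-- A decomposition `f = u · f₁ ^ n₁ ⋯ f_α ^ n_α` into irreducible factors, with `u` a unit, the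
`fᵢ` irreducible and pairwise non-associated, and `nᵢ ≥ 1`. -/
structure IrredDecomp {𝕜 : Type*} [NormedField 𝕜] {n : ℕ} (f : ConvergentSeries 𝕜 n) where
  α : ℕ
  u : (ConvergentSeries 𝕜 n)ˣ
  factor : Fin α → ConvergentSeries 𝕜 n
  exponent : Fin α → ℕ
  irreducible_factor : ∀ i, Irreducible (factor i)
  not_associated : ∀ i j, i ≠ j → ¬ Associated (factor i) (factor j)
  exponent_pos : ∀ i, 1 ≤ exponent i
  eq_prod : f = u * ∏ i, factor i ^ exponent i

namespace IrredDecomp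

variable {𝕜 : Type*} [NormedField 𝕜] {n : ℕ} {f g : ConvergentSeries 𝕜 n}

/-- The reduced equation `f_red = f₁ ⋯ f_α`. -/
noncomputable def red (F : IrredDecomp f) : ConvergentSeries 𝕜 n :=
  ∏ i, F.factor i

/-- The analytic `1`-form `f_red · df / f`, written without denominators: it is
`f_red · u⁻¹ du + ∑ᵢ nᵢ f₁ ⋯ f̂ᵢ ⋯ f_α dfᵢ` (the `i`-th factor is omitted in the product). -/
noncomputable def redLogDeriv (F : IrredDecomp f) : OneForm 𝕜 n :=
  (F.red * (F.u⁻¹ : (ConvergentSeries 𝕜 n)ˣ)) • d (F.u : ConvergentSeries 𝕜 n) +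
    ∑ i, (F.exponent i * ∏ j ∈ Finset.univ.erase i, F.factor j) • d (F.factor i)

/-- The `1`-form `θ_φ = f_red g_red (df / f - dg / g)` of `φ = f / g`. -/
noncomputable def theta (F : IrredDecomp f) (G : IrredDecomp g) : OneForm 𝕜 n :=
  G.red • F.redLogDeriv - F.red • G.redLogDeriv

end IrredDecomp

/-- `s` is (a representative of) the algebraic singular set of the `1`-form `ω`: a greatest common
divisor of the coefficients of `ω`. -/
def IsSingAlg {𝕜 : Type*} [NormedField 𝕜] {n : ℕ} (ω : OneForm 𝕜 n)
    (s : ConvergentSeries 𝕜 n) : Prop :=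
  (∀ k, s ∣ ω k) ∧ ∀ e : ConvergentSeries 𝕜 n, (∀ k, e ∣ ω k) → e ∣ s

/-- `h` is a component of multiplicity `ℓ` of the algebraic singular set of `ω`: an irreducible
factor of the greatest common divisor of the coefficients, occurring with exact exponent `ℓ ≥ 1`. -/
def IsSingAlgComponent {𝕜 : Type*} [NormedField 𝕜] {n : ℕ} (ω : OneForm 𝕜 n)
    (h : ConvergentSeries 𝕜 n) (l : ℕ) : Prop :=
  Irreducible h ∧ 1 ≤ l ∧ ∃ s, IsSingAlg ω s ∧ h ^ l ∣ s ∧ ¬ h ^ (l + 1) ∣ s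

/-- The condition `f - c g = h ^ (m + 1) s` for some real level `c ≠ 0`. -/
def RealLevel {n : ℕ} (f g h : ConvergentSeries ℝ n) (m : ℕ) : Prop :=
  ∃ (c : ℝ) (s : ConvergentSeries ℝ n), c ≠ 0 ∧ f - c • g = h ^ (m + 1) * s

/-- The condition that, up to sign, `h = ρ₁² + ρ₂²` and
`f² + |c|² g² - 2 Re(c) f g = (ρ₁² + ρ₂²) ^ (m + 1) (ς₁² + ς₂²)` for some non-real `c`. -/
def NonrealLevel {n : ℕ} (f g h : ConvergentSeries ℝ n) (m : ℕ) : Prop :=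
  ∃ (c : ℂ) (ρ₁ ρ₂ ς₁ ς₂ : ConvergentSeries ℝ n), c.im ≠ 0 ∧
    (h = ρ₁ ^ 2 + ρ₂ ^ 2 ∨ h = -(ρ₁ ^ 2 + ρ₂ ^ 2)) ∧
    f ^ 2 + (‖c‖ ^ 2) • g ^ 2 - (2 * c.re) • (f * g) =
      (ρ₁ ^ 2 + ρ₂ ^ 2) ^ (m + 1) * (ς₁ ^ 2 + ς₂ ^ 2)

end ConvergentSeries

/-!
If an irreducible `h` divides all `g ∂f - f ∂g`, then `f / g` should be constant along `h = 0`.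
After a linear change of coordinates and Weierstrass preparation, `h` is a Weierstrass polynomial in
`x₀`, so modulo `h` the series `f` and `g` satisfy a homogeneous relation `∑ aⱼ fʲ gᵉ⁻ʲ = 0` with
coefficients in `𝕜{x₁, …, xₙ}`. The derivations tangent to `h = 0` turn a relation of minimal degree
into one of smaller degree, so that `aₑ ∂ᵢaⱼ = aⱼ ∂ᵢaₑ` for all `i` and `j`: the coefficients are
proportional to constants. Hence `f / g` is algebraic over the constants modulo `h`, and over `ℂ`
it is congruent to a constant `c`. Conversely `g ∂f - f ∂g = g ∂(f - c g) - (f - c g) ∂g`, so the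
multiplicity of `h` in these Wronskians is one less than its multiplicity in `f - c g`; the factors
`f^red / f` and `g^red / g` do not change it.

Over `ℝ` one passes to the complexification. Either `h` stays irreducible in `ℂ{x}`, and then `c`
must be real, or `h = ± s s̄` with `s` irreducible, and then the power of `s` in `f - c g` is read
off from the norm `(f - c g) (f - c̄ g) = f² + |c|² g² - 2 Re(c) f g`.
-/

/-! ### Weighted `ℓ¹`-norms of power series -/

section PolydiscNorm

open scoped NNReal ENNReal

/-- The weighted `ℓ¹`-norm `∑ ν, ‖f_ν‖ ρ ^ ν` of a power series for a polyradius `ρ`, with value `∞`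
if the sum diverges. A series in finitely many variables is convergent iff its norm is finite for
some `ρ > 0`. -/
noncomputable def polydiscNorm {σ 𝕜 : Type*} [Fintype σ] [NormedField 𝕜] (ρ : σ → ℝ≥0)
    (f : MvPowerSeries σ 𝕜) : ℝ≥0∞ :=
  ∑' ν : σ →₀ ℕ, ‖MvPowerSeries.coeff ν f‖ₑ * ∏ i, (ρ i : ℝ≥0∞) ^ ν i

namespace polydiscNorm

open MvPowerSeries

variable {σ 𝕜 : Type*} [Fintype σ] [NormedField 𝕜]

theorem mono {ρ τ : σ → ℝ≥0} (h : ρ ≤ τ) (f : MvPowerSeries σ 𝕜) :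
    polydiscNorm ρ f ≤ polydiscNorm τ f := by
  refine ENNReal.tsum_le_tsum fun ν => ?_
  gcongr with i
  exact h i

theorem add_le (ρ : σ → ℝ≥0) (f g : MvPowerSeries σ 𝕜) :
    polydiscNorm ρ (f + g) ≤ polydiscNorm ρ f + polydiscNorm ρ g := by
  rw [polydiscNorm, polydiscNorm, polydiscNorm, ← ENNReal.tsum_add]
  refine ENNReal.tsum_le_tsum fun ν => ?_
  rw [← add_mul, map_add]
  gcongr
  exact enorm_add_le _ _

@[simp]
theorem neg (ρ : σ → ℝ≥0) (f : MvPowerSeries σ 𝕜) : polydiscNorm ρ (-f) = polydiscNorm ρ f := by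
  simp [polydiscNorm]

theorem sub_le (ρ : σ → ℝ≥0) (f g : MvPowerSeries σ 𝕜) :
    polydiscNorm ρ (f - g) ≤ polydiscNorm ρ f + polydiscNorm ρ g := by
  simpa [sub_eq_add_neg] using add_le ρ f (-g)

theorem monomial_eq (ρ : σ → ℝ≥0) (ν : σ →₀ ℕ) (c : 𝕜) :
    polydiscNorm ρ (monomial ν c) = ‖c‖ₑ * ∏ i, (ρ i : ℝ≥0∞) ^ ν i := by
  rw [polydiscNorm, tsum_eq_single ν fun μ hμ => by simp [coeff_monomial_ne hμ]]
  simp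

@[simp]
theorem one (ρ : σ → ℝ≥0) : polydiscNorm ρ (1 : MvPowerSeries σ 𝕜) = 1 := by
  simpa using monomial_eq (𝕜 := 𝕜) ρ 0 1

theorem X_eq (ρ : σ → ℝ≥0) (i : σ) : polydiscNorm ρ (X i : MvPowerSeries σ 𝕜) = ρ i := by
  classical
  rw [X_def, monomial_eq, Finset.prod_eq_single i (fun j _ hj => by simp [hj]) (by simp)]
  simp

theorem mul_le (ρ : σ → ℝ≥0) (f g : MvPowerSeries σ 𝕜) :
    polydiscNorm ρ (f * g) ≤ polydiscNorm ρ f * polydiscNorm ρ g := by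
  classical
  let term (f : MvPowerSeries σ 𝕜) (ν : σ →₀ ℕ) : ℝ≥0∞ := ‖coeff ν f‖ₑ * ∏ i, (ρ i : ℝ≥0∞) ^ ν i
  have cauchy_product (ν : σ →₀ ℕ) : term (f * g) ν ≤
      ∑' p : Finset.HasAntidiagonal.antidiagonal ν, term f p.1.1 * term g p.1.2 := by
    rw [Finset.tsum_subtype _ fun p : (σ →₀ ℕ) × (σ →₀ ℕ) => term f p.1 * term g p.2]
    simp only [term, coeff_mul]
    refine (mul_le_mul_left (enorm_sum_le _ _) _).trans ?_
    rw [Finset.sum_mul]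
    refine Finset.sum_le_sum fun p hp => le_of_eq ?_
    rw [← Finset.HasAntidiagonal.mem_antidiagonal.mp hp, enorm_mul]
    simp only [Finsupp.add_apply, pow_add, Finset.prod_mul_distrib]
    ring
  calc polydiscNorm ρ (f * g)
      ≤ ∑' ν, ∑' p : Finset.HasAntidiagonal.antidiagonal ν, term f p.1.1 * term g p.1.2 :=
        ENNReal.tsum_le_tsum cauchy_product
    _ = ∑' p : (σ →₀ ℕ) × (σ →₀ ℕ), term f p.1 * term g p.2 := by
        rw [← Finset.HasAntidiagonal.sigmaAntidiagonalEquivProd.tsum_eq, ENNReal.tsum_sigma']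
        rfl
    _ = polydiscNorm ρ f * polydiscNorm ρ g := by
        rw [ENNReal.tsum_prod (f := fun μ ν => term f μ * term g ν)]
        simp only [ENNReal.tsum_mul_left, ENNReal.tsum_mul_right]
        rfl

theorem pow_le (ρ : σ → ℝ≥0) (f : MvPowerSeries σ 𝕜) (k : ℕ) :
    polydiscNorm ρ (f ^ k) ≤ polydiscNorm ρ f ^ k := by
  induction k with
  | zero => simp
  | succ k ih =>
    rw [pow_succ, pow_succ]
    exact (mul_le _ _ _).trans (mul_le_mul_left ih _)

theorem prod_le {ι : Type*} (s : Finset ι) (ρ : σ → ℝ≥0) (f : ι → MvPowerSeries σ 𝕜) :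
    polydiscNorm ρ (∏ j ∈ s, f j) ≤ ∏ j ∈ s, polydiscNorm ρ (f j) := by
  classical
  induction s using Finset.induction_on with
  | empty => simp
  | insert a s ha ih =>
    rw [Finset.prod_insert ha, Finset.prod_insert ha]
    exact (mul_le _ _ _).trans (mul_le_mul_right ih _)

theorem enorm_coeff_mul_le (ρ : σ → ℝ≥0) (f : MvPowerSeries σ 𝕜) (ν : σ →₀ ℕ) :
    ‖coeff ν f‖ₑ * ∏ i, (ρ i : ℝ≥0∞) ^ ν i ≤ polydiscNorm ρ f :=
  ENNReal.le_tsum ν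

theorem prod_pow_ne_zero {ρ : σ → ℝ≥0} (hρ : ∀ i, 0 < ρ i) (ν : σ →₀ ℕ) :
    ∏ i, (ρ i : ℝ≥0∞) ^ ν i ≠ 0 :=
  Finset.prod_ne_zero_iff.2 fun i _ => pow_ne_zero _ (ENNReal.coe_ne_zero.2 (hρ i).ne')

theorem eq_zero_of_eq_zero {ρ : σ → ℝ≥0} (hρ : ∀ i, 0 < ρ i) {f : MvPowerSeries σ 𝕜}
    (h : polydiscNorm ρ f = 0) : f = 0 := by
  ext ν
  have hν := enorm_coeff_mul_le ρ f ν
  rw [h, nonpos_iff_eq_zero, mul_eq_zero, or_iff_left (prod_pow_ne_zero hρ ν)] at hν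
  simpa using hν

theorem const_eq (r : ℝ≥0) (f : MvPowerSeries σ 𝕜) :
    polydiscNorm (fun _ => r) f = ∑' ν : σ →₀ ℕ, ‖coeff ν f‖ₑ * (r : ℝ≥0∞) ^ ν.degree :=
  tsum_congr fun ν => by rw [Finset.prod_pow_eq_pow_sum, Finsupp.degree_eq_sum]

theorem tsum_le (ρ : σ → ℝ≥0) (u : ℕ → MvPowerSeries σ 𝕜) :
    polydiscNorm ρ (fun ν => ∑' k, coeff ν (u k)) ≤ ∑' k, polydiscNorm ρ (u k) := by
  simp only [polydiscNorm]
  rw [ENNReal.tsum_comm]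
  refine ENNReal.tsum_le_tsum fun ν => ?_
  rw [ENNReal.tsum_mul_right]
  gcongr
  exact enorm_tsum_le_tsum_enorm

theorem exists_sub_sum_range_le_tsum [CompleteSpace 𝕜] {ρ : σ → ℝ≥0} (hρ : ∀ i, 0 < ρ i)
    {u : ℕ → MvPowerSeries σ 𝕜} (hu : ∑' k, polydiscNorm ρ (u k) ≠ ∞) :
    ∃ q, ∀ K, polydiscNorm ρ (q - ∑ k ∈ Finset.range K, u k) ≤
      ∑' k, polydiscNorm ρ (u (k + K)) := by
  have summable_coeff (ν : σ →₀ ℕ) : Summable fun k => coeff ν (u k) := by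
    refine Summable.of_enorm fun htop => ?_
    have hν : (∑' k, ‖coeff ν (u k)‖ₑ) * ∏ i, (ρ i : ℝ≥0∞) ^ ν i ≠ ∞ := by
      rw [← ENNReal.tsum_mul_right]
      exact ne_top_of_le_ne_top hu (ENNReal.tsum_le_tsum fun k => enorm_coeff_mul_le ρ (u k) ν)
    exact hν (by rw [htop, ENNReal.top_mul (prod_pow_ne_zero hρ ν)])
  let tail (K : ℕ) : MvPowerSeries σ 𝕜 := fun ν => ∑' k, coeff ν (u (k + K))
  refine ⟨tail 0, fun K => ?_⟩
  suffices h : tail 0 - ∑ k ∈ Finset.range K, u k = tail K from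
    h ▸ tsum_le ρ fun k => u (k + K)
  ext ν
  rw [map_sub, map_sum, sub_eq_iff_eq_add']
  exact ((summable_coeff ν).sum_add_tsum_nat_add K).symm

theorem tsum_iterate_ne_top {ρ : σ → ℝ≥0} {T : MvPowerSeries σ 𝕜 → MvPowerSeries σ 𝕜} {c : ℝ≥0∞}
    (hc : c < 1) (hT : ∀ q, polydiscNorm ρ (T q) ≤ c * polydiscNorm ρ q) {p : MvPowerSeries σ 𝕜}
    (hp : polydiscNorm ρ p ≠ ∞) : ∑' k, polydiscNorm ρ (T^[k] p) ≠ ∞ := by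
  have iterate_le (k : ℕ) : polydiscNorm ρ (T^[k] p) ≤ c ^ k * polydiscNorm ρ p := by
    induction k with
    | zero => simp
    | succ k ih =>
      rw [Function.iterate_succ_apply', pow_succ', mul_assoc]
      exact (hT _).trans (mul_le_mul_right ih _)
  refine ne_top_of_le_ne_top ?_ (ENNReal.tsum_le_tsum iterate_le)
  rw [ENNReal.tsum_mul_right, ENNReal.tsum_geometric]
  exact ENNReal.mul_ne_top (ENNReal.inv_ne_top.2 (tsub_pos_of_lt hc).ne') hp

/-- The solution `q` is the Neumann series `∑ₖ Tᵏ p`. -/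
theorem exists_sub_apply_eq [CompleteSpace 𝕜] {ρ : σ → ℝ≥0} (hρ : ∀ i, 0 < ρ i)
    {T : AddMonoid.End (MvPowerSeries σ 𝕜)} {c : ℝ≥0∞} (hc : c < 1)
    (hT : ∀ q, polydiscNorm ρ (T q) ≤ c * polydiscNorm ρ q) {p : MvPowerSeries σ 𝕜}
    (hp : polydiscNorm ρ p ≠ ∞) : ∃ q, polydiscNorm ρ q ≠ ∞ ∧ q - T q = p := by
  let u (k : ℕ) : MvPowerSeries σ 𝕜 := T^[k] p
  have hu (k : ℕ) : T (u k) = u (k + 1) := (Function.iterate_succ_apply' T k p).symm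
  have summable_u : ∑' k, polydiscNorm ρ (u k) ≠ ∞ := tsum_iterate_ne_top hc hT hp
  obtain ⟨q, q_sub_le⟩ := exists_sub_sum_range_le_tsum hρ summable_u
  refine ⟨q, ne_top_of_le_ne_top summable_u (by simpa using q_sub_le 0),
    sub_eq_zero.1 (eq_zero_of_eq_zero hρ ?_)⟩
  let tail (K : ℕ) : ℝ≥0∞ := ∑' k, polydiscNorm ρ (u (k + K))
  have defect_le (K : ℕ) : polydiscNorm ρ (q - T q - p) ≤ 3 * tail K := by
    set s := ∑ k ∈ Finset.range K, u k with hs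
    have telescope : s - T s = p - u K := by
      rw [hs, map_sum, ← Finset.sum_sub_distrib]
      simp only [hu]
      exact Finset.sum_range_sub' u K
    have defect_eq : q - T q - p = (q - s) - T (q - s) - u K := by
      rw [map_sub]
      linear_combination telescope
    calc polydiscNorm ρ (q - T q - p)
        ≤ polydiscNorm ρ (q - s) + 1 * polydiscNorm ρ (q - s) + polydiscNorm ρ (u K) := by
          rw [defect_eq]
          refine (sub_le _ _ _).trans (add_le_add_left ((sub_le _ _ _).trans ?_) _)
          gcongr
          exact (hT _).trans (by gcongr)
      _ ≤ tail K + 1 * tail K + tail K := by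
          gcongr
          · exact q_sub_le K
          · exact q_sub_le K
          · simpa using ENNReal.le_tsum (f := fun k => polydiscNorm ρ (u (k + K))) 0
      _ = 3 * tail K := by ring
  have tail_tendsto : Filter.Tendsto (fun K => 3 * tail K) Filter.atTop (nhds 0) := by
    simpa using ENNReal.Tendsto.const_mul (ENNReal.tendsto_sum_nat_add _ summable_u) (a := 3)
      (Or.inr (by simp))
  exact le_antisymm (ge_of_tendsto' tail_tendsto defect_le) zero_le

theorem eq_zero_of_le_mul {ρ : σ → ℝ≥0} (hρ : ∀ i, 0 < ρ i) {q : MvPowerSeries σ 𝕜} {c : ℝ≥0∞}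
    (hc : c < 1) (hq : polydiscNorm ρ q ≠ ∞) (h : polydiscNorm ρ q ≤ c * polydiscNorm ρ q) :
    q = 0 := by
  refine eq_zero_of_eq_zero hρ (by_contra fun h0 => h.not_gt ?_)
  simpa using ENNReal.mul_lt_mul_left h0 hq hc

theorem piecewise_le [DecidableEq σ] {ρ : σ → ℝ≥0} {t : ℝ≥0} (ht : t ≤ 1) {s : Finset σ}
    {f : MvPowerSeries σ 𝕜} (hf : ∀ ν, coeff ν f ≠ 0 → ∃ i ∈ s, ν i ≠ 0) :
    polydiscNorm (s.piecewise (t • ρ) ρ) f ≤ t * polydiscNorm ρ f := by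
  rw [polydiscNorm, polydiscNorm, ← ENNReal.tsum_mul_left]
  refine ENNReal.tsum_le_tsum fun ν => ?_
  by_cases h0 : coeff ν f = 0
  · simp [h0]
  obtain ⟨j, hj, hj0⟩ := hf ν h0
  rw [mul_left_comm, ← Finset.mul_prod_erase _ _ (Finset.mem_univ j),
    ← Finset.mul_prod_erase _ (fun i => (ρ i : ℝ≥0∞) ^ ν i) (Finset.mem_univ j),
    ← mul_assoc (t : ℝ≥0∞)]
  have piecewise_le_self (i : σ) : s.piecewise (t • ρ) ρ i ≤ ρ i := by
    by_cases hi : i ∈ s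
    · simpa [hi] using mul_le_of_le_one_left zero_le ht
    · simp [hi]
  gcongr with i
  · simp only [hj, Finset.piecewise_eq_of_mem, Pi.smul_apply, smul_eq_mul, ENNReal.coe_mul, mul_pow]
    gcongr
    exact pow_le_of_le_one zero_le (by exact_mod_cast ht) hj0
  · exact piecewise_le_self i

theorem exists_piecewise_le [DecidableEq σ] {ρ : σ → ℝ≥0} {s : Finset σ} {f : MvPowerSeries σ 𝕜}
    (hf : ∀ ν, coeff ν f ≠ 0 → ∃ i ∈ s, ν i ≠ 0) (hfin : polydiscNorm ρ f ≠ ∞) {ε : ℝ≥0∞}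
    (hε : ε ≠ 0) :
    ∃ t : ℝ≥0, 0 < t ∧ t ≤ 1 ∧ polydiscNorm (s.piecewise (t • ρ) ρ) f ≤ ε := by
  obtain ⟨t, ht, hle⟩ := ENNReal.exists_nnreal_pos_mul_lt hfin hε
  refine ⟨min 1 t, lt_min one_pos ht, min_le_left _ _, ?_⟩
  refine (piecewise_le (min_le_left _ _) hf).trans (le_trans ?_ hle.le)
  gcongr
  exact min_le_right _ _

theorem subst_le {τ : Type*} [Fintype τ] {a : σ → MvPowerSeries τ 𝕜} (ha : HasSubst a)
    {ρ : τ → ℝ≥0} {r : σ → ℝ≥0} (h : ∀ i, polydiscNorm ρ (a i) ≤ r i) (f : MvPowerSeries σ 𝕜) :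
    polydiscNorm ρ (subst a f) ≤ polydiscNorm r f := by
  have coeff_subst_le (e : τ →₀ ℕ) :
      ‖coeff e (subst a f)‖ₑ ≤ ∑' d, ‖coeff d f‖ₑ * ‖coeff e (d.prod fun i k => a i ^ k)‖ₑ := by
    rw [coeff_subst ha, finsum_eq_sum _ (coeff_subst_finite ha f e)]
    refine ((enorm_sum_le _ _).trans (ENNReal.sum_le_tsum _)).trans (le_of_eq ?_)
    exact tsum_congr fun d => by rw [smul_eq_mul, enorm_mul]
  calc polydiscNorm ρ (subst a f)
      ≤ ∑' e : τ →₀ ℕ, ∑' d : σ →₀ ℕ, ‖coeff d f‖ₑ *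
          (‖coeff e (d.prod fun i k => a i ^ k)‖ₑ * ∏ i, (ρ i : ℝ≥0∞) ^ e i) := by
        refine ENNReal.tsum_le_tsum fun e => (mul_le_mul_left (coeff_subst_le e) _).trans ?_
        simp only [← ENNReal.tsum_mul_right, mul_assoc, le_refl]
    _ = ∑' d : σ →₀ ℕ, ‖coeff d f‖ₑ * polydiscNorm ρ (d.prod fun i k => a i ^ k) := by
        rw [ENNReal.tsum_comm]
        simp only [ENNReal.tsum_mul_left, polydiscNorm]
    _ ≤ polydiscNorm r f := by
        refine ENNReal.tsum_le_tsum fun d => ?_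
        gcongr
        rw [Finsupp.prod_fintype _ _ (by simp)]
        refine (prod_le _ _ _).trans ?_
        gcongr with i
        exact (pow_le _ _ _).trans (pow_le_pow_left₀ zero_le (h i) _)

end polydiscNorm

end PolydiscNorm

/-! ### Convergent power series -/

namespace IsConvergentSeries

open MvPowerSeries Filter Topology
open scoped NNReal ENNReal

variable {𝕜 : Type*} [NormedField 𝕜] {n : ℕ} {f : MvPowerSeries (Fin n) 𝕜}

theorem polydiscNorm_const_ne_top_iff {r : ℝ≥0} :
    polydiscNorm (fun _ => r) f ≠ ∞ ↔
      Summable fun ν : Fin n →₀ ℕ => ‖coeff ν f‖ * (r : ℝ) ^ ν.degree := by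
  have term_eq (ν : Fin n →₀ ℕ) : ‖coeff ν f‖ₑ * (r : ℝ≥0∞) ^ ν.degree =
      ((‖coeff ν f‖₊ * r ^ ν.degree : ℝ≥0) : ℝ≥0∞) := by
    push_cast
    rfl
  rw [polydiscNorm.const_eq, tsum_congr term_eq, ENNReal.tsum_coe_ne_top_iff_summable,
    ← NNReal.summable_coe]
  simp

theorem of_polydiscNorm_ne_top {ρ : Fin n → ℝ≥0} (hρ : ∀ i, 0 < ρ i)
    (h : polydiscNorm ρ f ≠ ∞) : IsConvergentSeries f := by
  obtain ⟨r, hr, hrpos⟩ := ((eventually_all.2 fun i => Ioc_mem_nhdsGT (hρ i)).and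
    self_mem_nhdsWithin : ∀ᶠ r in 𝓝[>] 0, (∀ i, r ∈ Set.Ioc 0 (ρ i)) ∧ r ∈ Set.Ioi 0).exists
  exact ⟨r, hrpos, polydiscNorm_const_ne_top_iff.1
    (ne_top_of_le_ne_top h (polydiscNorm.mono (fun i => (hr i).2) f))⟩

theorem eventually_polydiscNorm_ne_top (hf : IsConvergentSeries f) :
    ∀ᶠ r : ℝ≥0 in 𝓝[>] 0, polydiscNorm (fun _ => r) f ≠ ∞ := by
  obtain ⟨r, hr, hsum⟩ := hf
  lift r to ℝ≥0 using hr.le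
  filter_upwards [Ioc_mem_nhdsGT hr] with s hs
  exact ne_top_of_le_ne_top (polydiscNorm_const_ne_top_iff.2 hsum)
    (polydiscNorm.mono (fun _ => hs.2) f)

theorem eventually_polydiscNorm_le (hf : IsConvergentSeries f) (h0 : constantCoeff f = 0)
    {ε : ℝ≥0∞} (hε : ε ≠ 0) : ∀ᶠ r : ℝ≥0 in 𝓝[>] 0, polydiscNorm (fun _ => r) f ≤ ε := by
  obtain ⟨r, hfin, hr⟩ := (hf.eventually_polydiscNorm_ne_top.and self_mem_nhdsWithin).exists
  have exists_ne_zero (ν : Fin n →₀ ℕ) (hν : coeff ν f ≠ 0) : ∃ i ∈ Finset.univ, ν i ≠ 0 := by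
    by_contra! hν0
    have : ν = 0 := Finsupp.ext fun i => hν0 i (Finset.mem_univ i)
    exact hν (by rw [this, coeff_zero_eq_constantCoeff_apply, h0])
  obtain ⟨t, ht, -, hle⟩ := polydiscNorm.exists_piecewise_le exists_ne_zero hfin hε
  filter_upwards [Ioc_mem_nhdsGT (mul_pos ht hr)] with s hs
  exact (polydiscNorm.mono (fun i => by simpa using hs.2) f).trans hle

theorem subst {m : ℕ} {a : Fin n → MvPowerSeries (Fin m) 𝕜} (ha : ∀ i, IsConvergentSeries (a i))
    (ha0 : ∀ i, constantCoeff (a i) = 0) (hf : IsConvergentSeries f) :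
    IsConvergentSeries (f.subst a) := by
  obtain ⟨r, hfin, hr⟩ := (hf.eventually_polydiscNorm_ne_top.and self_mem_nhdsWithin).exists
  have hr0 : (r : ℝ≥0∞) ≠ 0 := ENNReal.coe_ne_zero.2 (ne_of_gt hr)
  obtain ⟨s, hle, hs⟩ := ((eventually_all.2 fun i =>
    (ha i).eventually_polydiscNorm_le (ha0 i) hr0).and self_mem_nhdsWithin).exists
  exact of_polydiscNorm_ne_top (fun _ => hs) (ne_top_of_le_ne_top hfin
    (polydiscNorm.subst_le (hasSubst_of_constantCoeff_zero ha0) hle f))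

theorem X (i : Fin n) : IsConvergentSeries (X i : MvPowerSeries (Fin n) 𝕜) :=
  of_polydiscNorm_ne_top (ρ := fun _ => 1) (fun _ => one_pos) (by simp [polydiscNorm.X_eq])

theorem exists_sub_mul_eq_one [CompleteSpace 𝕜] (hf : IsConvergentSeries f)
    (h0 : constantCoeff f = 0) : ∃ q, IsConvergentSeries q ∧ (1 - f) * q = 1 := by
  obtain ⟨r, hle, hr⟩ := ((hf.eventually_polydiscNorm_le h0 (ε := 2⁻¹) (by simp)).and
    self_mem_nhdsWithin).exists
  obtain ⟨q, hq, h⟩ := polydiscNorm.exists_sub_apply_eq (𝕜 := 𝕜) (ρ := fun _ : Fin n => r)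
    (fun _ => hr) (T := AddMonoidHom.mulLeft f) (c := 2⁻¹) (by simp)
    (fun q => (polydiscNorm.mul_le _ _ _).trans (mul_le_mul_left hle _)) (p := 1) (by simp)
  exact ⟨q, of_polydiscNorm_ne_top (fun _ => hr) hq, by rw [sub_mul, one_mul]; exact h⟩

end IsConvergentSeries

namespace ConvergentSeries

variable {𝕜 : Type*} [NormedField 𝕜] {m n : ℕ}

/-- Evaluation at the origin. -/
noncomputable def evalZero : ConvergentSeries 𝕜 n →ₐ[𝕜] 𝕜 where
  __ := MvPowerSeries.constantCoeff.comp (ConvergentSeries 𝕜 n).val.toRingHom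
  commutes' c := by simp [MvPowerSeries.algebraMap_apply]

theorem evalZero_apply (a : ConvergentSeries 𝕜 n) :
    evalZero a = MvPowerSeries.constantCoeff a.1 := rfl

theorem isUnit_iff [CompleteSpace 𝕜] {a : ConvergentSeries 𝕜 n} : IsUnit a ↔ evalZero a ≠ 0 := by
  refine ⟨fun h => (h.map evalZero).ne_zero, fun h => ?_⟩
  set b : ConvergentSeries 𝕜 n := 1 - (evalZero a)⁻¹ • a with hb
  have hb0 : evalZero b = 0 := by simp [hb, h]
  obtain ⟨q, hq, hbq⟩ := b.2.exists_sub_mul_eq_one hb0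
  have isUnit_smul : IsUnit ((evalZero a)⁻¹ • a) :=
    .of_mul_eq_one ⟨q, hq⟩ (Subtype.ext (by simpa [hb] using hbq))
  simpa [h] using isUnit_smul.smul (Units.mk0 _ h)

/-- The partial derivative `∂/∂xᵢ` as a derivation of `𝕜{x}`. -/
noncomputable def pderivDerivation (i : Fin n) :
    Derivation 𝕜 (ConvergentSeries 𝕜 n) (ConvergentSeries 𝕜 n) where
  toFun := pderiv i
  map_add' a b := Subtype.ext (map_add (MvPowerSeries.pderiv 𝕜 i) a.1 b.1)
  map_smul' c a := Subtype.ext ((MvPowerSeries.pderiv 𝕜 i).map_smul c a.1)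
  map_one_eq_zero' := Subtype.ext (MvPowerSeries.pderiv 𝕜 i).map_one_eq_zero
  leibniz' a b := Subtype.ext ((MvPowerSeries.pderiv 𝕜 i).leibniz a.1 b.1)

@[simp]
theorem pderivDerivation_apply (i : Fin n) (a : ConvergentSeries 𝕜 n) :
    pderivDerivation i a = pderiv i a := rfl

theorem pderiv_mul (i : Fin n) (a b : ConvergentSeries 𝕜 n) :
    pderiv i (a * b) = a * pderiv i b + b * pderiv i a :=
  (pderivDerivation i).leibniz a b

/-- The coordinate function `xᵢ` as an element of `𝕜{x}`. -/
noncomputable def X (i : Fin n) : ConvergentSeries 𝕜 n :=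
  ⟨MvPowerSeries.X i, .X i⟩

@[simp]
theorem evalZero_X (i : Fin n) : evalZero (X i : ConvergentSeries 𝕜 n) = 0 :=
  MvPowerSeries.constantCoeff_X i

theorem hasSubst_coe {a : Fin m → ConvergentSeries 𝕜 n} (ha : ∀ i, evalZero (a i) = 0) :
    MvPowerSeries.HasSubst fun i => (a i).1 :=
  MvPowerSeries.hasSubst_of_constantCoeff_zero ha

/-- Substitution of convergent series without constant term. -/
noncomputable def substHom (a : Fin m → ConvergentSeries 𝕜 n) (ha : ∀ i, evalZero (a i) = 0) :
    ConvergentSeries 𝕜 m →ₐ[𝕜] ConvergentSeries 𝕜 n :=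
  ((MvPowerSeries.substAlgHom (hasSubst_coe ha)).comp
    (ConvergentSeries 𝕜 m).val).codRestrict (ConvergentSeries 𝕜 n) fun f => by
      rw [AlgHom.comp_apply, MvPowerSeries.substAlgHom_apply]
      exact .subst (fun i => (a i).2) ha f.2

theorem coe_substHom (a : Fin m → ConvergentSeries 𝕜 n) (ha : ∀ i, evalZero (a i) = 0)
    (f : ConvergentSeries 𝕜 m) :
    (substHom a ha f).1 = MvPowerSeries.subst (fun i => (a i).1) f.1 :=
  MvPowerSeries.substAlgHom_apply (hasSubst_coe ha) f.1

@[simp]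
theorem substHom_X (a : Fin m → ConvergentSeries 𝕜 n) (ha : ∀ i, evalZero (a i) = 0)
    (i : Fin m) : substHom a ha (X i) = a i := by
  refine Subtype.ext ?_
  rw [coe_substHom]
  exact MvPowerSeries.subst_X (hasSubst_coe ha) i

/-- The inclusion `𝕜{x₁, …, xₙ} → 𝕜{x₀, …, xₙ}`. -/
noncomputable def liftSucc : ConvergentSeries 𝕜 n →ₐ[𝕜] ConvergentSeries 𝕜 (n + 1) :=
  substHom (fun i => X i.succ) fun i => evalZero_X i.succ

theorem coe_liftSucc (a : ConvergentSeries 𝕜 n) :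
    (liftSucc a).1 = MvPowerSeries.rename (Fin.succEmb n) a.1 := by
  rw [liftSucc, coe_substHom, MvPowerSeries.rename_eq_subst]
  rfl

theorem embDomain_succEmb_eq_cons (x : Fin n →₀ ℕ) : x.embDomain (Fin.succEmb n) = x.cons 0 := by
  ext i
  refine Fin.cases ?_ (fun j => ?_) i
  · rw [Finsupp.cons_zero, Finsupp.embDomain_of_notMem_range]
    simp
  · rw [Finsupp.cons_succ]
    exact Finsupp.embDomain_apply_self (Fin.succEmb n) x j

theorem coeff_cons_liftSucc (a : ConvergentSeries 𝕜 n) (k : ℕ) (x : Fin n →₀ ℕ) :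
    MvPowerSeries.coeff (x.cons k) (liftSucc a).1 =
      if k = 0 then MvPowerSeries.coeff x a.1 else 0 := by
  rw [coe_liftSucc]
  split_ifs with hk
  · rw [hk, ← embDomain_succEmb_eq_cons, MvPowerSeries.coeff_embDomain_rename]
  · refine MvPowerSeries.coeff_rename_eq_zero _ _ ?_
    rintro ⟨y, hy⟩
    rw [← Finsupp.embDomain_eq_mapDomain, embDomain_succEmb_eq_cons] at hy
    exact hk (by simpa using (DFunLike.congr_fun hy 0).symm)

/-- A polynomial in `x₀` over `𝕜{x₁, …, xₙ}`, viewed as an element of `𝕜{x₀, …, xₙ}`. -/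
noncomputable def ofPoly :
    Polynomial (ConvergentSeries 𝕜 n) →+* ConvergentSeries 𝕜 (n + 1) :=
  Polynomial.eval₂RingHom (liftSucc : ConvergentSeries 𝕜 n →ₐ[𝕜] _).toRingHom (X 0)

@[simp]
theorem ofPoly_C (a : ConvergentSeries 𝕜 n) : ofPoly (Polynomial.C a) = liftSucc a := by
  simp [ofPoly]

@[simp]
theorem ofPoly_X : ofPoly (Polynomial.X : Polynomial (ConvergentSeries 𝕜 n)) = X 0 := by
  simp [ofPoly]

theorem finSuccEquiv_ofPoly (P : Polynomial (ConvergentSeries 𝕜 n)) :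
    MvPowerSeries.finSuccEquiv 𝕜 n (ofPoly P).1 =
      (P.map (ConvergentSeries 𝕜 n).val.toRingHom : PowerSeries (MvPowerSeries (Fin n) 𝕜)) := by
  have ringHom_eq : ((MvPowerSeries.finSuccEquiv 𝕜 n).toRingEquiv.toRingHom.comp
      (ConvergentSeries 𝕜 (n + 1)).val.toRingHom).comp ofPoly =
      Polynomial.coeToPowerSeries.ringHom.comp
        (Polynomial.mapRingHom (ConvergentSeries 𝕜 n).val.toRingHom) := by
    refine Polynomial.ringHom_ext (fun a => ?_) ?_
    · ext k x
      have := coeff_cons_liftSucc a k x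
      rw [← MvPowerSeries.coeff_coeff_finSuccEquiv] at this
      simpa [PowerSeries.coeff_C, apply_ite] using this
    · have : MvPowerSeries.finSuccEquiv 𝕜 n (X 0).1 = PowerSeries.X :=
        MvPowerSeries.finSuccEquiv_X_zero
      simpa using this
  exact DFunLike.congr_fun ringHom_eq P

theorem coeff_cons_ofPoly (P : Polynomial (ConvergentSeries 𝕜 n)) (k : ℕ) (x : Fin n →₀ ℕ) :
    MvPowerSeries.coeff (x.cons k) (ofPoly P).1 = MvPowerSeries.coeff x (P.coeff k).1 := by
  rw [← MvPowerSeries.coeff_coeff_finSuccEquiv, finSuccEquiv_ofPoly]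
  simp

theorem ofPoly_injective :
    Function.Injective (ofPoly : Polynomial (ConvergentSeries 𝕜 n) →+* _) := by
  intro P Q h
  ext k : 1
  refine Subtype.ext (MvPowerSeries.ext fun x => ?_)
  rw [← coeff_cons_ofPoly, ← coeff_cons_ofPoly, h]

end ConvergentSeries

/-! ### Weierstrass division and preparation -/

section Division

open MvPowerSeries Filter Topology
open scoped NNReal ENNReal

/-- The quotient of the division of a power series by `Xᵢ ^ d`, as a linear map: the monomials not
divisible by `Xᵢ ^ d` are discarded. -/
noncomputable def divXPow {σ R : Type*} [Semiring R] (i : σ) (d : ℕ) :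
    MvPowerSeries σ R →ₗ[R] MvPowerSeries σ R where
  toFun f := fun ν => coeff (ν + Finsupp.single i d) f
  map_add' _ _ := rfl
  map_smul' _ _ := rfl

theorem coeff_divXPow {σ R : Type*} [Semiring R] (i : σ) (d : ℕ) (f : MvPowerSeries σ R)
    (ν : σ →₀ ℕ) : coeff ν (divXPow i d f) = coeff (ν + Finsupp.single i d) f := rfl

theorem divXPow_X_pow_mul {σ R : Type*} [Semiring R] (i : σ) (d : ℕ) (f : MvPowerSeries σ R) :
    divXPow i d (X i ^ d * f) = f := by
  ext ν
  rw [coeff_divXPow, X_pow_eq, add_comm ν, coeff_add_monomial_mul, one_mul]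

variable {𝕜 : Type*} [NormedField 𝕜] {n : ℕ}

theorem polydiscNorm.pow_mul_divXPow_le {σ : Type*} [Fintype σ] (ρ : σ → ℝ≥0) (i : σ) (d : ℕ)
    (f : MvPowerSeries σ 𝕜) :
    (ρ i : ℝ≥0∞) ^ d * polydiscNorm ρ (divXPow i d f) ≤ polydiscNorm ρ f := by
  classical
  have prod_single : ∏ j, (ρ j : ℝ≥0∞) ^ Finsupp.single i d j = (ρ i : ℝ≥0∞) ^ d := by
    rw [Finset.prod_eq_single i (fun j _ hj => by simp [hj]) (by simp)]
    simp
  refine le_trans (le_of_eq ?_) (ENNReal.tsum_comp_le_tsum_of_injective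
    (add_left_injective (Finsupp.single i d))
    fun ν => ‖coeff ν f‖ₑ * ∏ i, (ρ i : ℝ≥0∞) ^ ν i)
  rw [polydiscNorm, ← ENNReal.tsum_mul_left]
  refine tsum_congr fun ν => ?_
  simp only [coeff_divXPow, Finsupp.add_apply, pow_add, Finset.prod_mul_distrib, prod_single]
  ring

theorem polydiscNorm.pow_mul_coeff_finSuccEquiv_le (ρ : Fin (n + 1) → ℝ≥0) (k : ℕ)
    (f : MvPowerSeries (Fin (n + 1)) 𝕜) :
    (ρ 0 : ℝ≥0∞) ^ k * polydiscNorm (Fin.tail ρ) (PowerSeries.coeff k (finSuccEquiv 𝕜 n f)) ≤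
      polydiscNorm ρ f := by
  refine le_trans (le_of_eq ?_) (ENNReal.tsum_comp_le_tsum_of_injective
    (Finsupp.cons_right_injective k) fun ν => ‖coeff ν f‖ₑ * ∏ i, (ρ i : ℝ≥0∞) ^ ν i)
  rw [polydiscNorm, ← ENNReal.tsum_mul_left]
  refine tsum_congr fun x => ?_
  rw [coeff_coeff_finSuccEquiv, Fin.prod_univ_succ]
  simp only [Finsupp.cons_zero, Finsupp.cons_succ, Fin.tail]
  ring

theorem IsConvergentSeries.divXPow {f : MvPowerSeries (Fin n) 𝕜} (hf : IsConvergentSeries f)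
    (i : Fin n) (d : ℕ) : IsConvergentSeries (divXPow i d f) := by
  obtain ⟨r, hfin, hr⟩ := (hf.eventually_polydiscNorm_ne_top.and self_mem_nhdsWithin).exists
  refine of_polydiscNorm_ne_top (ρ := fun _ => r) (fun _ => hr) fun htop => hfin ?_
  have := polydiscNorm.pow_mul_divXPow_le (fun _ => r) i d f
  rwa [htop, ENNReal.mul_top (by simp [ne_of_gt hr]), top_le_iff] at this

theorem IsConvergentSeries.coeff_finSuccEquiv {f : MvPowerSeries (Fin (n + 1)) 𝕜}
    (hf : IsConvergentSeries f) (k : ℕ) :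
    IsConvergentSeries (PowerSeries.coeff k (finSuccEquiv 𝕜 n f)) := by
  obtain ⟨r, hfin, hr⟩ := (hf.eventually_polydiscNorm_ne_top.and self_mem_nhdsWithin).exists
  refine of_polydiscNorm_ne_top (ρ := Fin.tail fun _ => r) (fun _ => hr) fun htop => hfin ?_
  have := polydiscNorm.pow_mul_coeff_finSuccEquiv_le (fun _ => r) k f
  rwa [htop, ENNReal.mul_top (by simp [ne_of_gt hr]), top_le_iff] at this

end Division

namespace ConvergentSeries

open MvPowerSeries Filter Topology
open scoped NNReal ENNReal

variable {𝕜 : Type*} [NormedField 𝕜] {n : ℕ}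

/-- Restriction to the `x₀`-axis. -/
noncomputable def axis : ConvergentSeries 𝕜 (n + 1) →ₐ[𝕜] PowerSeries 𝕜 where
  __ := (PowerSeries.map constantCoeff).comp ((finSuccEquiv 𝕜 n).toRingEquiv.toRingHom.comp
    (ConvergentSeries 𝕜 (n + 1)).val.toRingHom)
  commutes' c := by
    simp [MvPowerSeries.algebraMap_apply, finSuccEquiv_C]

theorem coeff_axis (k : ℕ) (f : ConvergentSeries 𝕜 (n + 1)) :
    PowerSeries.coeff k (axis f) = coeff (Finsupp.single 0 k) f.1 := by
  rw [← Finsupp.cons_zero_eq_single_zero, ← coeff_coeff_finSuccEquiv]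
  exact PowerSeries.coeff_map (constantCoeff (σ := Fin n) (R := 𝕜)) k (finSuccEquiv 𝕜 n f.1)

theorem constantCoeff_axis (f : ConvergentSeries 𝕜 (n + 1)) :
    PowerSeries.constantCoeff (axis f) = evalZero f := by
  rw [← PowerSeries.coeff_zero_eq_constantCoeff_apply, coeff_axis, evalZero_apply]
  simp

theorem axis_ofPoly (P : Polynomial (ConvergentSeries 𝕜 n)) :
    axis (ofPoly P) = (P.map (evalZero : _ →ₐ[𝕜] 𝕜).toRingHom : Polynomial 𝕜) := by
  ext k
  rw [coeff_axis, ← Finsupp.cons_zero_eq_single_zero, coeff_cons_ofPoly, Polynomial.coeff_coe,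
    Polynomial.coeff_map]
  rfl

theorem ofPoly_sub (P Q : Polynomial (ConvergentSeries 𝕜 n)) :
    ofPoly (P - Q) = ofPoly P - ofPoly Q :=
  RingHom.map_sub ofPoly P Q

theorem axis_X_zero : axis (X 0 : ConvergentSeries 𝕜 (n + 1)) = PowerSeries.X := by
  rw [← ofPoly_X, axis_ofPoly]
  simp

theorem axis_X_succ (i : Fin n) : axis (X i.succ : ConvergentSeries 𝕜 (n + 1)) = 0 := by
  have : (X i.succ : ConvergentSeries 𝕜 (n + 1)) = ofPoly (Polynomial.C (X i)) := by
    rw [ofPoly_C, liftSucc, substHom_X]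
  rw [this, axis_ofPoly]
  simp

/-- `g` is `x₀`-regular of order `d`: its restriction to the `x₀`-axis vanishes exactly to order
`d`. -/
def IsRegularOfOrder (d : ℕ) (g : ConvergentSeries 𝕜 (n + 1)) : Prop :=
  (axis g).order = d

theorem axis_divXPow_of_dvd {d : ℕ} {g : ConvergentSeries 𝕜 (n + 1)}
    (h : PowerSeries.X ^ d ∣ axis g) :
    axis g = PowerSeries.X ^ d * axis ⟨divXPow 0 d g.1, g.2.divXPow 0 d⟩ := by
  obtain ⟨φ, hφ⟩ := h
  rw [hφ]
  congr 1
  ext k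
  rw [coeff_axis, coeff_divXPow, ← Finsupp.single_add, ← coeff_axis, hφ,
    PowerSeries.coeff_X_pow_mul]

theorem IsRegularOfOrder.exists_unit_mul_eq [CompleteSpace 𝕜] {d : ℕ}
    {g : ConvergentSeries 𝕜 (n + 1)} (hg : IsRegularOfOrder d g) :
    ∃ (u : (ConvergentSeries 𝕜 (n + 1))ˣ) (w : ConvergentSeries 𝕜 (n + 1)),
      axis w = 0 ∧ (u : ConvergentSeries 𝕜 (n + 1)) * g = X 0 ^ d - w := by
  set s : ConvergentSeries 𝕜 (n + 1) := ⟨divXPow 0 d g.1, g.2.divXPow 0 d⟩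
  have axis_eq : axis g = PowerSeries.X ^ d * axis s :=
    axis_divXPow_of_dvd (PowerSeries.X_pow_dvd_iff.2 (PowerSeries.order_eq_nat.1 hg).2)
  have isUnit_s : IsUnit s := by
    rw [isUnit_iff, ← constantCoeff_axis, ← PowerSeries.coeff_zero_eq_constantCoeff_apply,
      ← PowerSeries.coeff_X_pow_mul (axis s) d 0, ← axis_eq, zero_add]
    exact (PowerSeries.order_eq_nat.1 hg).1
  obtain ⟨u, hu⟩ := isUnit_s
  refine ⟨u⁻¹, X 0 ^ d - ((u⁻¹ : (ConvergentSeries 𝕜 (n + 1))ˣ) : ConvergentSeries 𝕜 (n + 1)) * g,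
    ?_, (sub_sub_cancel _ _).symm⟩
  rw [map_sub, map_pow, axis_X_zero, map_mul, axis_eq, ← hu, mul_left_comm, ← map_mul, u.inv_mul,
    map_one, mul_one, sub_self]

/-- It suffices to shrink the radii of the variables other than `x₀`. -/
theorem exists_polyradius {w : ConvergentSeries 𝕜 (n + 1)} (hw : axis w = 0)
    (f : ConvergentSeries 𝕜 (n + 1)) (d : ℕ) {c : ℝ≥0∞} (hc : c ≠ 0) :
    ∃ ρ : Fin (n + 1) → ℝ≥0, (∀ i, 0 < ρ i) ∧ polydiscNorm ρ f.1 ≠ ∞ ∧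
      polydiscNorm ρ w.1 ≤ c * (ρ 0 : ℝ≥0∞) ^ d := by
  obtain ⟨r, ⟨hwr, hfr⟩, hr⟩ := ((w.2.eventually_polydiscNorm_ne_top.and
    f.2.eventually_polydiscNorm_ne_top).and self_mem_nhdsWithin).exists
  have exists_ne_zero (ν : Fin (n + 1) →₀ ℕ) (hν : coeff ν w.1 ≠ 0) :
      ∃ i ∈ ({0}ᶜ : Finset (Fin (n + 1))), ν i ≠ 0 := by
    by_contra! hν0
    have ν_eq : ν = Finsupp.single 0 (ν 0) := by
      ext i
      by_cases hi : i = 0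
      · simp [hi]
      · rw [hν0 i (by simpa using hi), Finsupp.single_eq_of_ne hi]
    exact hν (by rw [ν_eq, ← coeff_axis, hw, map_zero])
  obtain ⟨t, ht, ht1, hle⟩ := polydiscNorm.exists_piecewise_le exists_ne_zero hwr
    (ε := c * (r : ℝ≥0∞) ^ d) (mul_ne_zero hc (pow_ne_zero _ (by simpa using ne_of_gt hr)))
  refine ⟨Finset.piecewise {0}ᶜ (t • fun _ => r) fun _ => r, fun i => ?_,
    ne_top_of_le_ne_top hfr (polydiscNorm.mono (fun i => ?_) f.1), by simpa using hle⟩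
  · exact Finset.piecewise_cases {0}ᶜ (t • fun _ => r) (fun _ => r) (0 < ·) (mul_pos ht hr) hr
  · exact Finset.piecewise_cases {0}ᶜ (t • fun _ => r) (fun _ => r) (· ≤ r)
      (mul_le_of_le_one_left zero_le ht1) le_rfl

theorem polydiscNorm_divXPow_mul_le {ρ : Fin (n + 1) → ℝ≥0} (hρ : ∀ i, 0 < ρ i) {d : ℕ}
    {w : MvPowerSeries (Fin (n + 1)) 𝕜} {c : ℝ≥0∞}
    (hw : polydiscNorm ρ w ≤ c * (ρ 0 : ℝ≥0∞) ^ d) (q : MvPowerSeries (Fin (n + 1)) 𝕜) :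
    polydiscNorm ρ (divXPow 0 d (w * q)) ≤ c * polydiscNorm ρ q := by
  have h0 : (ρ 0 : ℝ≥0∞) ^ d ≠ 0 := by simp [(hρ 0).ne']
  rw [← ENNReal.mul_le_mul_iff_right h0 (by simp)]
  calc (ρ 0 : ℝ≥0∞) ^ d * polydiscNorm ρ (divXPow 0 d (w * q))
      ≤ polydiscNorm ρ (w * q) := polydiscNorm.pow_mul_divXPow_le ρ 0 d _
    _ ≤ polydiscNorm ρ w * polydiscNorm ρ q := polydiscNorm.mul_le _ _ _
    _ ≤ c * (ρ 0 : ℝ≥0∞) ^ d * polydiscNorm ρ q := by gcongr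
    _ = (ρ 0 : ℝ≥0∞) ^ d * (c * polydiscNorm ρ q) := by ring

theorem divXPow_mul_X_pow_sub (q w : MvPowerSeries (Fin (n + 1)) 𝕜) (d : ℕ) :
    divXPow 0 d (q * (MvPowerSeries.X 0 ^ d - w)) = q - divXPow 0 d (w * q) := by
  rw [mul_sub, map_sub, mul_comm q, divXPow_X_pow_mul, mul_comm q]

/-- Division by `x₀ ^ d - w` amounts to inverting `1 - T`, where `T q` is the quotient of `w q` by
`x₀ ^ d`. -/
theorem exists_divXPow_sub_mul_eq_zero [CompleteSpace 𝕜] {w : ConvergentSeries 𝕜 (n + 1)}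
    (hw : axis w = 0) (f : ConvergentSeries 𝕜 (n + 1)) (d : ℕ) :
    ∃ q : ConvergentSeries 𝕜 (n + 1), divXPow 0 d (f - q * (X 0 ^ d - w)).1 = 0 := by
  obtain ⟨ρ, hρ, hfin, hle⟩ :=
    exists_polyradius hw ⟨divXPow 0 d f.1, f.2.divXPow 0 d⟩ d (c := 2⁻¹) (by simp)
  obtain ⟨q, hq, hqf⟩ := polydiscNorm.exists_sub_apply_eq hρ (by simp)
    (T := (divXPow 0 d).toAddMonoidHom.comp (AddMonoidHom.mulLeft w.1))
    (polydiscNorm_divXPow_mul_le hρ hle) hfin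
  refine ⟨⟨q, .of_polydiscNorm_ne_top hρ hq⟩, (map_sub (divXPow 0 d) f.1 _).trans ?_⟩
  exact sub_eq_zero.2 (hqf.symm.trans (divXPow_mul_X_pow_sub q w.1 d).symm)

theorem eq_zero_of_divXPow_mul_eq_zero {w q : ConvergentSeries 𝕜 (n + 1)} (hw : axis w = 0)
    {d : ℕ} (h : divXPow 0 d (q * (X 0 ^ d - w)).1 = 0) : q = 0 := by
  obtain ⟨ρ, hρ, hfin, hle⟩ := exists_polyradius hw q d (c := 2⁻¹) (by simp)
  refine Subtype.ext (polydiscNorm.eq_zero_of_le_mul hρ (c := 2⁻¹) (by simp) hfin ?_)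
  have q_eq : q.1 = divXPow 0 d (w.1 * q.1) :=
    sub_eq_zero.1 ((divXPow_mul_X_pow_sub q.1 w.1 d).symm.trans h)
  conv_lhs => rw [q_eq]
  exact polydiscNorm_divXPow_mul_le hρ hle q.1

theorem exists_ofPoly_eq {d : ℕ} {f : ConvergentSeries 𝕜 (n + 1)} (hf : divXPow 0 d f.1 = 0) :
    ∃ P : Polynomial (ConvergentSeries 𝕜 n), P.degree < d ∧ ofPoly P = f := by
  let φ : PowerSeries (ConvergentSeries 𝕜 n) :=
    PowerSeries.mk fun k => ⟨_, f.2.coeff_finSuccEquiv k⟩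
  refine ⟨φ.trunc d, PowerSeries.degree_trunc_lt φ d, Subtype.ext (MvPowerSeries.ext fun ν => ?_)⟩
  rw [← Finsupp.cons_tail ν, coeff_cons_ofPoly, PowerSeries.coeff_trunc]
  split_ifs with hν
  · simp only [φ, PowerSeries.coeff_mk, coeff_coeff_finSuccEquiv]
  · have ν_eq : ν = (ν - Finsupp.single 0 d) + Finsupp.single 0 d :=
      (tsub_add_cancel_of_le (by simpa using hν)).symm
    rw [Finsupp.cons_tail, ν_eq, ← coeff_divXPow, hf]
    simp

theorem divXPow_ofPoly_eq_zero {d : ℕ} {P : Polynomial (ConvergentSeries 𝕜 n)}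
    (hP : P.degree < d) : divXPow 0 d (ofPoly P).1 = 0 := by
  ext ν
  have degree_lt : P.degree < ((ν + Finsupp.single 0 d : Fin (n + 1) →₀ ℕ) 0 : ℕ) := by
    refine hP.trans_le ?_
    rw [Finsupp.add_apply, Finsupp.single_eq_same]
    exact_mod_cast Nat.le_add_left d (ν 0)
  rw [coeff_divXPow, ← Finsupp.cons_tail (ν + Finsupp.single 0 d), coeff_cons_ofPoly,
    Polynomial.coeff_eq_zero_of_degree_lt degree_lt]
  simp

theorem IsRegularOfOrder.exists_eq_mul_add [CompleteSpace 𝕜] {d : ℕ}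
    {g : ConvergentSeries 𝕜 (n + 1)} (hg : IsRegularOfOrder d g)
    (f : ConvergentSeries 𝕜 (n + 1)) :
    ∃ (q : ConvergentSeries 𝕜 (n + 1)) (P : Polynomial (ConvergentSeries 𝕜 n)),
      P.degree < d ∧ f = q * g + ofPoly P := by
  obtain ⟨u, w, hw, hu⟩ := hg.exists_unit_mul_eq
  obtain ⟨q, hq⟩ := exists_divXPow_sub_mul_eq_zero hw f d
  obtain ⟨P, hP, hPf⟩ := exists_ofPoly_eq hq
  refine ⟨q * u, P, hP, ?_⟩
  rw [hPf, mul_assoc, hu]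
  ring

theorem IsRegularOfOrder.eq_zero_of_mul_eq [CompleteSpace 𝕜] {d : ℕ}
    {g q : ConvergentSeries 𝕜 (n + 1)} (hg : IsRegularOfOrder d g)
    {P : Polynomial (ConvergentSeries 𝕜 n)} (hP : P.degree < d) (h : q * g = ofPoly P) :
    P = 0 := by
  obtain ⟨u, w, hw, hu⟩ := hg.exists_unit_mul_eq
  set v := q * (u⁻¹ : (ConvergentSeries 𝕜 (n + 1))ˣ) with hv
  have v_mul : v * (X 0 ^ d - w) = ofPoly P := by
    rw [← hu, ← h, hv, mul_assoc, Units.inv_mul_cancel_left]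
  have v_eq_zero : v = 0 :=
    eq_zero_of_divXPow_mul_eq_zero hw (v_mul ▸ divXPow_ofPoly_eq_zero hP)
  rw [v_eq_zero, zero_mul] at v_mul
  exact ofPoly_injective (by rw [← v_mul, map_zero])

/-- A Weierstrass polynomial: a monic polynomial over `𝕜{x₁, …, xₙ}` whose lower coefficients
vanish at the origin. -/
structure IsWeierstrass (P : Polynomial (ConvergentSeries 𝕜 n)) : Prop where
  monic : P.Monic
  map_evalZero : P.map (evalZero : _ →ₐ[𝕜] 𝕜).toRingHom = Polynomial.X ^ P.natDegree

theorem IsWeierstrass.isRegularOfOrder {P : Polynomial (ConvergentSeries 𝕜 n)}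
    (hP : IsWeierstrass P) : IsRegularOfOrder P.natDegree (ofPoly P) := by
  rw [IsRegularOfOrder, axis_ofPoly, hP.map_evalZero]
  simp [PowerSeries.order_X_pow]

theorem IsRegularOfOrder.eq_zero_of_X_pow_eq {d : ℕ} {g q : ConvergentSeries 𝕜 (n + 1)}
    (hg : IsRegularOfOrder d g) {r : Polynomial (ConvergentSeries 𝕜 n)} (hr : r.degree < d)
    (h : X 0 ^ d = q * g + ofPoly r) : r.map (evalZero : _ →ₐ[𝕜] 𝕜).toRingHom = 0 := by
  have X_pow_dvd : PowerSeries.X ^ d ∣ axis (ofPoly r) := by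
    rw [← add_sub_cancel_left (q * g) (ofPoly r), ← h, map_sub, map_pow, axis_X_zero, map_mul]
    exact dvd_sub dvd_rfl (Dvd.dvd.mul_left
      (PowerSeries.X_pow_dvd_iff.2 (PowerSeries.order_eq_nat.1 hg).2) _)
  ext k
  rcases lt_or_ge k d with hk | hk
  · simpa [axis_ofPoly] using PowerSeries.X_pow_dvd_iff.1 X_pow_dvd k hk
  · rw [Polynomial.coeff_map, Polynomial.coeff_eq_zero_of_degree_lt
      (hr.trans_le (by exact_mod_cast hk)), map_zero, Polynomial.coeff_zero]

theorem IsRegularOfOrder.isUnit_of_axis_mul_eq [CompleteSpace 𝕜] {d : ℕ}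
    {g q : ConvergentSeries 𝕜 (n + 1)} (hg : IsRegularOfOrder d g)
    (h : axis (q * g) = PowerSeries.X ^ d) : IsUnit q := by
  have order_add : (axis q).order + d = 0 + d := by
    rw [← show (axis g).order = d from hg, ← PowerSeries.order_mul, ← map_mul, h,
      PowerSeries.order_X_pow, zero_add, hg]
  have order_eq_zero : (axis q).order = 0 :=
    ENat.add_left_injective_of_ne_top (ENat.natCast_ne_top d) order_add
  rw [isUnit_iff, ← constantCoeff_axis, ← PowerSeries.coeff_zero_eq_constantCoeff_apply]
  exact (PowerSeries.order_eq_nat.1 order_eq_zero).1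

theorem IsRegularOfOrder.exists_associated_ofPoly [CompleteSpace 𝕜] {d : ℕ}
    {g : ConvergentSeries 𝕜 (n + 1)} (hg : IsRegularOfOrder d g) :
    ∃ P : Polynomial (ConvergentSeries 𝕜 n), IsWeierstrass P ∧ P.natDegree = d ∧
      Associated (ofPoly P) g := by
  obtain ⟨q, r, hr, h⟩ := hg.exists_eq_mul_add (X 0 ^ d)
  have map_r := hg.eq_zero_of_X_pow_eq hr h
  have ofPoly_eq : ofPoly (Polynomial.X ^ d - r) = q * g := by
    rw [ofPoly_sub, map_pow, ofPoly_X, h, add_sub_cancel_right]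
  obtain ⟨u, rfl⟩ : IsUnit q := hg.isUnit_of_axis_mul_eq (by
    rw [← ofPoly_eq, axis_ofPoly, Polynomial.map_sub, map_r]
    simp)
  have natDegree_eq : (Polynomial.X ^ d - r).natDegree = d := by
    rw [Polynomial.natDegree_eq_of_degree_eq_some (n := d)]
    rw [Polynomial.degree_sub_eq_left_of_degree_lt] <;> simp [hr]
  refine ⟨Polynomial.X ^ d - r, ⟨Polynomial.monic_X_pow_sub hr, ?_⟩, natDegree_eq, ?_⟩
  · rw [natDegree_eq, Polynomial.map_sub, map_r]
    simp
  · rw [ofPoly_eq]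
    exact associated_unit_mul_left g u u.isUnit

theorem IsWeierstrass.dvd_of_ofPoly_dvd [CompleteSpace 𝕜]
    {P Q : Polynomial (ConvergentSeries 𝕜 n)} (hP : IsWeierstrass P) (h : ofPoly P ∣ ofPoly Q) :
    P ∣ Q := by
  obtain ⟨q, hq⟩ := h
  rw [← Polynomial.modByMonic_eq_zero_iff_dvd hP.monic]
  refine hP.isRegularOfOrder.eq_zero_of_mul_eq (q := q - ofPoly (Q /ₘ P)) ?_ ?_
  · rw [← Polynomial.degree_eq_natDegree hP.monic.ne_zero]
    exact Polynomial.degree_modByMonic_lt Q hP.monic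
  · rw [Polynomial.modByMonic_eq_sub_mul_div, ofPoly_sub, map_mul, hq]
    ring

theorem IsWeierstrass.prime_ofPoly [CompleteSpace 𝕜] {P : Polynomial (ConvergentSeries 𝕜 n)}
    (hP : IsWeierstrass P) (hp : Prime P) : Prime (ofPoly P) := by
  refine ⟨fun h => hp.ne_zero (ofPoly_injective (by rw [h, map_zero])), fun h => ?_,
    fun a b hab => ?_⟩
  · have : ofPoly P ∣ ofPoly 1 := by simpa using h.dvd
    exact hp.not_isUnit (isUnit_of_dvd_one (hP.dvd_of_ofPoly_dvd this))
  · obtain ⟨qa, ra, -, ha⟩ := hP.isRegularOfOrder.exists_eq_mul_add a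
    obtain ⟨qb, rb, -, hb⟩ := hP.isRegularOfOrder.exists_eq_mul_add b
    have dvd_remainders : ofPoly P ∣ ofPoly (ra * rb) := by
      have : ofPoly (ra * rb) = a * b - ofPoly P * (qa * b + ofPoly ra * qb) := by
        rw [map_mul, ha, hb]
        ring
      rw [this]
      exact dvd_sub hab (dvd_mul_right _ _)
    rw [ha, hb]
    exact (hp.dvd_or_dvd (hP.dvd_of_ofPoly_dvd dvd_remainders)).imp
      (fun h => dvd_add (dvd_mul_left _ _) (map_dvd ofPoly h))
      fun h => dvd_add (dvd_mul_left _ _) (map_dvd ofPoly h)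

theorem IsWeierstrass.exists_associated_of_dvd {P Q : Polynomial (ConvergentSeries 𝕜 n)}
    (hP : IsWeierstrass P) (h : Q ∣ P) :
    ∃ Q' : Polynomial (ConvergentSeries 𝕜 n), IsWeierstrass Q' ∧ Associated Q' Q := by
  obtain ⟨R, hR⟩ := h
  have leadingCoeff_mul : Q.leadingCoeff * R.leadingCoeff = 1 := by
    rw [← Polynomial.leadingCoeff_mul, ← hR, hP.monic.leadingCoeff]
  set Q' := Q * Polynomial.C R.leadingCoeff
  have monic : Q'.Monic := by
    rw [Polynomial.Monic, Polynomial.leadingCoeff_mul, Polynomial.leadingCoeff_C,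
      leadingCoeff_mul]
  have associated : Associated Q' Q := associated_mul_unit_left _ _
    ((IsUnit.of_mul_eq_one_right _ leadingCoeff_mul).map Polynomial.C)
  have map_dvd_X_pow : Q'.map (evalZero : _ →ₐ[𝕜] 𝕜).toRingHom ∣ Polynomial.X ^ P.natDegree := by
    rw [← hP.map_evalZero]
    exact map_dvd (Polynomial.mapRingHom _) (associated.dvd.trans ⟨R, hR⟩)
  obtain ⟨i, -, hi⟩ := (dvd_prime_pow Polynomial.prime_X _).1 map_dvd_X_pow
  have map_eq := Polynomial.eq_of_monic_of_associated (monic.map _) (Polynomial.monic_X_pow i) hi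
  have natDegree_eq := congrArg Polynomial.natDegree map_eq
  rw [monic.natDegree_map, Polynomial.natDegree_X_pow] at natDegree_eq
  exact ⟨Q', ⟨monic, by rw [map_eq, natDegree_eq]⟩, associated⟩

theorem IsRegularOfOrder.exists_prime_factors [CompleteSpace 𝕜]
    [UniqueFactorizationMonoid (ConvergentSeries 𝕜 n)] {d : ℕ}
    {g : ConvergentSeries 𝕜 (n + 1)} (hg : IsRegularOfOrder d g) :
    ∃ s : Multiset (ConvergentSeries 𝕜 (n + 1)), (∀ b ∈ s, Prime b) ∧ Associated s.prod g := by
  obtain ⟨P, hP, -, hPg⟩ := hg.exists_associated_ofPoly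
  obtain ⟨s, hs, hsP⟩ := UniqueFactorizationMonoid.exists_prime_factors P hP.monic.ne_zero
  refine ⟨s.map ofPoly, fun b hb => ?_, ?_⟩
  · obtain ⟨Q, hQ, rfl⟩ := Multiset.mem_map.1 hb
    obtain ⟨Q', hQ', hass⟩ := hP.exists_associated_of_dvd ((Multiset.dvd_prod hQ).trans hsP.dvd)
    exact (hass.map ofPoly).prime (hQ'.prime_ofPoly (hass.symm.prime (hs Q hQ)))
  · rw [← map_multiset_prod]
    exact (hsP.map ofPoly).trans hPg

end ConvergentSeries

/-! ### Linear changes of coordinates and unique factorization -/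

namespace ConvergentSeries

section ChangeOfCoordinates

open MvPowerSeries (coeff)

variable {𝕜 : Type*} [NormedField 𝕜] {n : ℕ}

theorem evalZero_substHom {m : ℕ} (a : Fin m → ConvergentSeries 𝕜 n)
    (ha : ∀ i, evalZero (a i) = 0) {f : ConvergentSeries 𝕜 m} (hf : evalZero f = 0) :
    evalZero (substHom a ha f) = 0 := by
  rw [evalZero_apply, coe_substHom]
  exact MvPowerSeries.constantCoeff_subst_eq_zero (hasSubst_coe ha) ha hf

theorem substHom_substHom {m k : ℕ} (a : Fin m → ConvergentSeries 𝕜 n)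
    (ha : ∀ i, evalZero (a i) = 0) (b : Fin k → ConvergentSeries 𝕜 m)
    (hb : ∀ i, evalZero (b i) = 0) (f : ConvergentSeries 𝕜 k) :
    substHom a ha (substHom b hb f) =
      substHom (fun i => substHom a ha (b i)) (fun i => evalZero_substHom a ha (hb i)) f := by
  refine Subtype.ext ?_
  simp only [coe_substHom]
  exact MvPowerSeries.subst_comp_subst_apply (hasSubst_coe hb) (hasSubst_coe ha) f.1

theorem substHom_eq_self {a : Fin n → ConvergentSeries 𝕜 n} (ha : ∀ i, evalZero (a i) = 0)
    (h : ∀ i, a i = X i) (f : ConvergentSeries 𝕜 n) : substHom a ha f = f := by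
  obtain rfl : a = X := funext h
  refine Subtype.ext ?_
  rw [coe_substHom]
  exact congrFun MvPowerSeries.subst_self f.1

/-- The images of the coordinates under the linear map that sends the `x₀`-axis to the line
spanned by `p` and fixes the directions of the other axes. -/
noncomputable def shearCoord (p : Fin (n + 1) → 𝕜) : Fin (n + 1) → ConvergentSeries 𝕜 (n + 1) :=
  Fin.cons (p 0 • X 0) fun i => X i.succ + p i.succ • X 0

theorem evalZero_shearCoord (p : Fin (n + 1) → 𝕜) (i : Fin (n + 1)) :
    evalZero (shearCoord p i) = 0 := by
  cases i using Fin.cases <;> simp [shearCoord]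

theorem substHom_shearCoord_comp {p q : Fin (n + 1) → 𝕜} (h_zero : q 0 * p 0 = 1)
    (h_succ : ∀ i : Fin n, p i.succ + q i.succ * p 0 = 0) (f : ConvergentSeries 𝕜 (n + 1)) :
    substHom (shearCoord p) (evalZero_shearCoord p)
      (substHom (shearCoord q) (evalZero_shearCoord q) f) = f := by
  rw [substHom_substHom]
  refine substHom_eq_self _ (fun i => ?_) f
  cases i using Fin.cases with
  | zero => simp [shearCoord, smul_smul, h_zero]
  | succ j => simp [shearCoord, smul_smul, add_assoc, ← add_smul, h_succ j]

/-- The linear change of coordinates that sends the `x₀`-axis to the line spanned by `p`. -/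
noncomputable def shear (p : Fin (n + 1) → 𝕜) (hp : p 0 ≠ 0) :
    ConvergentSeries 𝕜 (n + 1) ≃ₐ[𝕜] ConvergentSeries 𝕜 (n + 1) :=
  AlgEquiv.ofAlgHom (substHom (shearCoord p) (evalZero_shearCoord p))
    (substHom (shearCoord (Fin.cons (p 0)⁻¹ fun i => -p i.succ * (p 0)⁻¹))
      (evalZero_shearCoord _))
    (AlgHom.ext fun f => substHom_shearCoord_comp (by simp [hp]) (fun i => by simp [hp]) f)
    (AlgHom.ext fun f => substHom_shearCoord_comp (by simp [hp]) (by simp) f)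

theorem axis_shearCoord (p : Fin (n + 1) → 𝕜) (i : Fin (n + 1)) :
    axis (shearCoord p i) = p i • PowerSeries.X := by
  cases i using Fin.cases <;> simp [shearCoord, axis_X_zero, axis_X_succ]

/-- The homogeneous component of degree `k` of a power series. -/
noncomputable def homogeneousPart {σ R : Type*} [Finite σ] [CommSemiring R] (k : ℕ)
    (f : MvPowerSeries σ R) : MvPolynomial σ R :=
  MvPolynomial.homogeneousComponent k (MvPowerSeries.truncTotal (k + 1) f)

theorem coeff_homogeneousPart {σ R : Type*} [Finite σ] [CommSemiring R] (k : ℕ)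
    (f : MvPowerSeries σ R) (d : σ →₀ ℕ) :
    (homogeneousPart k f).coeff d = if d.degree = k then coeff d f else 0 := by
  rw [homogeneousPart, MvPolynomial.coeff_homogeneousComponent]
  split_ifs with h
  · exact MvPowerSeries.coeff_truncTotal f (h.trans_lt k.lt_succ_self)
  · rfl

theorem coeff_axis_substHom {m : ℕ} {a : Fin m → ConvergentSeries 𝕜 (n + 1)}
    (ha : ∀ i, evalZero (a i) = 0) {p : Fin m → 𝕜}
    (h : ∀ i, axis (a i) = p i • PowerSeries.X) (f : ConvergentSeries 𝕜 m) (k : ℕ) :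
    PowerSeries.coeff k (axis (substHom a ha f)) = (homogeneousPart k f.1).eval p := by
  have coeff_prod (d : Fin m →₀ ℕ) :
      coeff (Finsupp.single 0 k) (d.prod fun i e => (a i).1 ^ e) =
        if d.degree = k then ∏ i, p i ^ d i else 0 := by
    have coe_prod : (d.prod fun i e => (a i).1 ^ e) = (∏ i, a i ^ d i).1 := by
      rw [Finsupp.prod_fintype _ _ (by simp)]
      exact (map_prod (ConvergentSeries 𝕜 (n + 1)).val (fun i => a i ^ d i) Finset.univ).symm
    rw [coe_prod, ← coeff_axis, map_prod]
    simp only [map_pow, h, smul_pow, Finset.prod_smul, Finset.prod_pow_eq_pow_sum,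
      ← Finsupp.degree_eq_sum, PowerSeries.coeff_smul, PowerSeries.coeff_X_pow]
    simp [eq_comm]
  rw [coeff_axis, coe_substHom, MvPowerSeries.coeff_subst (hasSubst_coe ha),
    MvPolynomial.eval_eq', finsum_eq_sum_of_support_subset (s := (homogeneousPart k f.1).support)]
  · refine Finset.sum_congr rfl fun d _ => ?_
    rw [coeff_prod, coeff_homogeneousPart]
    split_ifs <;> simp
  · intro d hd
    rw [Function.mem_support, coeff_prod] at hd
    rw [Finset.mem_coe, MvPolynomial.mem_support_iff, coeff_homogeneousPart]
    split_ifs at hd ⊢ with hdk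
    · exact left_ne_zero_of_mul hd
    · simp at hd

theorem exists_shear_isRegularOfOrder [Infinite 𝕜] {f : ConvergentSeries 𝕜 (n + 1)}
    (hf : f ≠ 0) : ∃ (p : Fin (n + 1) → 𝕜) (hp : p 0 ≠ 0) (d : ℕ),
      IsRegularOfOrder d (shear p hp f) := by
  obtain ⟨ν, hν⟩ : ∃ ν, coeff ν f.1 ≠ 0 := by
    by_contra! h
    exact hf (Subtype.ext (MvPowerSeries.ext h))
  set H := homogeneousPart ν.degree f.1
  have H_ne_zero : H ≠ 0 := fun h => hν <| by
    simpa [H, coeff_homogeneousPart] using congrArg (MvPolynomial.coeff ν) h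
  obtain ⟨p, hp⟩ : ∃ p, (MvPolynomial.X 0 * H).eval p ≠ 0 := by
    by_contra! h
    exact mul_ne_zero (MvPolynomial.X_ne_zero 0) H_ne_zero
      (MvPolynomial.funext fun p => by simpa using h p)
  rw [map_mul, MvPolynomial.eval_X] at hp
  have hp0 := left_ne_zero_of_mul hp
  have axis_ne_zero : axis (shear p hp0 f) ≠ 0 := fun h => right_ne_zero_of_mul hp <|
    (coeff_axis_substHom (evalZero_shearCoord p) (axis_shearCoord p) f ν.degree).symm.trans <| by
      rw [← map_zero (PowerSeries.coeff ν.degree), ← h]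
      rfl
  exact ⟨p, hp0, _, (ENat.natCast_toNat (PowerSeries.order_eq_top.not.2 axis_ne_zero)).symm⟩

end ChangeOfCoordinates

instance uniqueFactorizationMonoid {𝕜 : Type*} [NontriviallyNormedField 𝕜] [CompleteSpace 𝕜] :
    ∀ n : ℕ, UniqueFactorizationMonoid (ConvergentSeries 𝕜 n)
  | 0 => by
    refine UniqueFactorizationMonoid.of_exists_prime_factors fun a ha => ⟨0, by simp, ?_⟩
    rw [Multiset.prod_zero]
    refine (associated_one_iff_isUnit.2 (isUnit_iff.2 fun h => ha ?_)).symm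
    refine Subtype.ext (MvPowerSeries.ext fun ν => ?_)
    rw [Subsingleton.elim ν 0]
    exact h
  | n + 1 => by
    have := uniqueFactorizationMonoid (𝕜 := 𝕜) n
    refine UniqueFactorizationMonoid.of_exists_prime_factors fun a ha => ?_
    obtain ⟨p, hp, d, hd⟩ := exists_shear_isRegularOfOrder ha
    obtain ⟨s, hs, hsa⟩ := hd.exists_prime_factors
    refine ⟨s.map (shear p hp).symm, fun b hb => ?_, ?_⟩
    · obtain ⟨c, hc, rfl⟩ := Multiset.mem_map.1 hb
      exact (MulEquiv.prime_iff (shear p hp).symm.toMulEquiv).2 (hs c hc)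
    · have := hsa.map (shear p hp).symm
      rwa [map_multiset_prod, AlgEquiv.symm_apply_apply] at this

end ConvergentSeries

/-! ### Derivations -/

section LexOrder

open MvPowerSeries

variable {σ R : Type*} [CommRing R]

theorem coeff_X_mul_pderiv (i : σ) (a : MvPowerSeries σ R) (ν : σ →₀ ℕ) :
    coeff ν (X i * pderiv R i a) = ν i * coeff ν a := by
  classical
  rw [X_def, coeff_monomial_mul, one_mul]
  split_ifs with h
  · have one_le : 1 ≤ ν i := by simpa using h
    rw [coeff_pderiv, tsub_add_cancel_of_le h, Finsupp.tsub_apply, Finsupp.single_eq_same,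
      Nat.cast_sub one_le]
    push_cast
    ring
  · have : ν i = 0 := by
      by_contra h0
      exact h (by simpa using Nat.one_le_iff_ne_zero.2 h0)
    simp [this]

variable [LinearOrder σ] [WellFoundedGT σ]

theorem le_lexOrder_X_mul_pderiv (i : σ) (a : MvPowerSeries σ R) :
    lexOrder a ≤ lexOrder (X i * pderiv R i a) := by
  rw [le_lexOrder_iff]
  intro d hd
  rw [coeff_X_mul_pderiv, coeff_eq_zero_of_lt_lexOrder hd, mul_zero]

theorem coeff_add_mul_of_le_lexOrder {φ ψ : MvPowerSeries σ R} {p q : σ →₀ ℕ}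
    (hp : toLex p ≤ lexOrder φ) (hq : toLex q ≤ lexOrder ψ) :
    coeff (p + q) (φ * ψ) = coeff p φ * coeff q ψ := by
  rw [coeff_mul, Finset.sum_eq_single_of_mem ⟨p, q⟩ (by simp)]
  rintro ⟨u, v⟩ h hne
  rw [Finset.HasAntidiagonal.mem_antidiagonal] at h
  rcases trichotomy_of_add_eq_add (congrArg toLex h) with heq | hlt | hlt
  · exact absurd (Prod.ext heq.1 heq.2) hne
  · rw [coeff_eq_zero_of_lt_lexOrder (d := u), zero_mul]
    exact lt_of_lt_of_le (by exact_mod_cast hlt) hp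
  · rw [coeff_eq_zero_of_lt_lexOrder (d := v), mul_zero]
    exact lt_of_lt_of_le (by exact_mod_cast hlt) hq

theorem toLex_zero_le_lexOrder (φ : MvPowerSeries σ R) :
    ((toLex (0 : σ →₀ ℕ) : Lex (σ →₀ ℕ)) : WithTop (Lex (σ →₀ ℕ))) ≤ lexOrder φ := by
  rw [le_lexOrder_iff]
  intro d hd
  exact absurd (WithTop.coe_lt_coe.1 hd) not_lt_bot

theorem constantCoeff_ne_zero_of_dvd_pderiv [IsDomain R] [CharZero R] {a : MvPowerSeries σ R}
    (ha : a ≠ 0) (h : ∀ i, a ∣ pderiv R i a) : constantCoeff a ≠ 0 := by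
  obtain ⟨ν, hν⟩ := exists_finsupp_eq_lexOrder_of_ne_zero ha
  have coeff_ne_zero : coeff ν a ≠ 0 := coeff_ne_zero_of_lexOrder hν.symm
  have ν_eq_zero : ν = 0 := by
    ext i
    obtain ⟨b, hb⟩ := h i
    have coeff_mul : coeff (ν + 0) (a * (X i * b)) = coeff ν a * coeff 0 (X i * b) :=
      coeff_add_mul_of_le_lexOrder hν.ge (toLex_zero_le_lexOrder _)
    rw [mul_left_comm, ← hb, add_zero, coeff_X_mul_pderiv, coeff_zero_X_mul, mul_zero,
      mul_eq_zero] at coeff_mul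
    simpa using coeff_mul.resolve_right coeff_ne_zero
  rwa [← coeff_zero_eq_constantCoeff_apply, ← ν_eq_zero]

theorem lexOrder_eq_of_mul_pderiv_eq [IsDomain R] [CharZero R] {a b : MvPowerSeries σ R}
    (ha : a ≠ 0) (hb : b ≠ 0) (h : ∀ i, a * pderiv R i b = b * pderiv R i a) :
    lexOrder a = lexOrder b := by
  obtain ⟨ν, hν⟩ := exists_finsupp_eq_lexOrder_of_ne_zero ha
  obtain ⟨μ, hμ⟩ := exists_finsupp_eq_lexOrder_of_ne_zero hb
  have coeff_mul_ne_zero : coeff ν a * coeff μ b ≠ 0 :=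
    mul_ne_zero (coeff_ne_zero_of_lexOrder hν.symm) (coeff_ne_zero_of_lexOrder hμ.symm)
  rw [hν, hμ]
  congr 2
  ext i
  have coeff_left : coeff (ν + μ) (a * (X i * pderiv R i b)) = coeff ν a * (μ i * coeff μ b) := by
    rw [coeff_add_mul_of_le_lexOrder hν.ge (hμ.ge.trans (le_lexOrder_X_mul_pderiv i b)),
      coeff_X_mul_pderiv]
  have coeff_right : coeff (ν + μ) ((X i * pderiv R i a) * b) = ν i * coeff ν a * coeff μ b := by
    rw [coeff_add_mul_of_le_lexOrder (hν.ge.trans (le_lexOrder_X_mul_pderiv i a)) hμ.ge,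
      coeff_X_mul_pderiv]
  rw [mul_left_comm, h i, mul_comm b, ← mul_assoc, coeff_right] at coeff_left
  have : ((ν i : R) - μ i) * (coeff ν a * coeff μ b) = 0 := by linear_combination coeff_left
  exact_mod_cast sub_eq_zero.1 ((mul_eq_zero.1 this).resolve_right coeff_mul_ne_zero)

/-- If `c` is the quotient of the lexicographically first coefficients, then `b - c a` has another
lexicographic order than `a`, although `a` and `b - c a` have the same logarithmic derivatives. -/
theorem exists_eq_smul_of_mul_pderiv_eq {𝕜 : Type*} [Field 𝕜] [CharZero 𝕜]
    {a b : MvPowerSeries σ 𝕜} (ha : a ≠ 0) (h : ∀ i, a * pderiv 𝕜 i b = b * pderiv 𝕜 i a) :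
    ∃ c : 𝕜, b = c • a := by
  obtain ⟨ν, hν⟩ := exists_finsupp_eq_lexOrder_of_ne_zero ha
  have coeff_ne_zero : coeff ν a ≠ 0 := coeff_ne_zero_of_lexOrder hν.symm
  refine ⟨coeff ν b / coeff ν a, ?_⟩
  by_contra hne
  have lexOrder_eq := lexOrder_eq_of_mul_pderiv_eq ha (sub_ne_zero.2 hne) fun i => by
    rw [map_sub, Derivation.map_smul, smul_eq_C_mul, smul_eq_C_mul]
    linear_combination h i
  refine coeff_ne_zero_of_lexOrder (hν.symm.trans lexOrder_eq) ?_
  rw [map_sub, coeff_smul, div_mul_cancel₀ _ coeff_ne_zero, sub_self]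

end LexOrder

namespace ConvergentSeries

variable {𝕜 : Type*} [NormedField 𝕜] {n : ℕ}

theorem exists_eq_liftSucc_add_X_mul (a : ConvergentSeries 𝕜 (n + 1)) :
    ∃ (a₀ : ConvergentSeries 𝕜 n) (b : ConvergentSeries 𝕜 (n + 1)), a = liftSucc a₀ + X 0 * b := by
  set b : ConvergentSeries 𝕜 (n + 1) := ⟨divXPow 0 1 a.1, a.2.divXPow 0 1⟩
  have divXPow_sub : divXPow 0 1 (a - X 0 * b).1 = 0 := by
    have := divXPow_X_pow_mul 0 1 (divXPow 0 1 a.1)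
    rw [pow_one] at this
    exact (map_sub (divXPow 0 1) a.1 _).trans (sub_eq_zero.2 this.symm)
  obtain ⟨P, hP, hPa⟩ := exists_ofPoly_eq divXPow_sub
  refine ⟨P.coeff 0, b, ?_⟩
  rw [← ofPoly_C, ← Polynomial.eq_C_of_degree_le_zero (Order.le_of_lt_succ (by exact_mod_cast hP)),
    hPa, sub_add_cancel]

theorem exists_eq_sum_X_mul : ∀ {n : ℕ} (a : ConvergentSeries 𝕜 n),
    ∃ (c : 𝕜) (b : Fin n → ConvergentSeries 𝕜 n),
      a = algebraMap 𝕜 (ConvergentSeries 𝕜 n) c + ∑ i, X i * b i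
  | 0, a => by
    refine ⟨evalZero a, Fin.elim0, Subtype.ext (MvPowerSeries.ext fun ν => ?_)⟩
    rw [Subsingleton.elim ν 0, Finset.univ_eq_empty, Finset.sum_empty, add_zero]
    exact (MvPowerSeries.coeff_zero_C _).symm
  | n + 1, a => by
    obtain ⟨a₀, b₀, rfl⟩ := exists_eq_liftSucc_add_X_mul a
    obtain ⟨c, b, rfl⟩ := exists_eq_sum_X_mul a₀
    refine ⟨c, Fin.cons b₀ fun i => liftSucc (b i), ?_⟩
    rw [Fin.sum_univ_succ, map_add, AlgHom.commutes, map_sum]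
    simp only [map_mul, liftSucc, substHom_X, Fin.cons_zero, Fin.cons_succ]
    ring

theorem derivation_eq_zero (D : Derivation 𝕜 (ConvergentSeries 𝕜 n) (ConvergentSeries 𝕜 n))
    (hD : ∀ i, D (X i) = 0) (a : ConvergentSeries 𝕜 n) : D a = 0 := by
  suffices coeff_eq_zero : ∀ (k : ℕ) (a : ConvergentSeries 𝕜 n) (ν : Fin n →₀ ℕ), ν.degree < k →
      MvPowerSeries.coeff ν (D a).1 = 0 from
    Subtype.ext (MvPowerSeries.ext fun ν => coeff_eq_zero _ a ν ν.degree.lt_succ_self)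
  intro k
  induction k with
  | zero => exact fun a ν hν => absurd hν ν.degree.not_lt_zero
  | succ k ih =>
    intro a ν hν
    obtain ⟨c, b, rfl⟩ := exists_eq_sum_X_mul a
    have D_eq : (D (algebraMap 𝕜 (ConvergentSeries 𝕜 n) c + ∑ i, X i * b i)).1 =
        ∑ i, MvPowerSeries.X i * (D (b i)).1 := by
      rw [map_add, Derivation.map_algebraMap, zero_add, map_sum]
      simp only [Derivation.leibniz, hD, smul_eq_mul, mul_zero, add_zero]
      exact map_sum (ConvergentSeries 𝕜 n).val (fun i => X i * D (b i)) Finset.univ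
    rw [D_eq, map_sum]
    refine Finset.sum_eq_zero fun i _ => ?_
    rw [MvPowerSeries.X_def, MvPowerSeries.coeff_monomial_mul]
    split_ifs with h
    · have degree_eq := congrArg Finsupp.degree (tsub_add_cancel_of_le h)
      rw [map_add, Finsupp.degree_single] at degree_eq
      rw [ih _ _ (by omega), mul_zero]
    · rfl

theorem pderiv_X_self (i : Fin n) : pderiv i (X i : ConvergentSeries 𝕜 n) = 1 :=
  Subtype.ext MvPowerSeries.pderiv_X_self

theorem pderiv_X_of_ne {i j : Fin n} (h : j ≠ i) : pderiv i (X j : ConvergentSeries 𝕜 n) = 0 :=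
  Subtype.ext (MvPowerSeries.pderiv_X_of_ne h)

theorem derivation_eq_sum (D : Derivation 𝕜 (ConvergentSeries 𝕜 n) (ConvergentSeries 𝕜 n))
    (a : ConvergentSeries 𝕜 n) : D a = ∑ i, D (X i) * pderiv i a := by
  have sum_apply (b) : (∑ i, D (X i) • pderivDerivation i) b = ∑ i, D (X i) * pderiv i b :=
    (congrFun (map_sum (Derivation.coeFnAddMonoidHom (R := 𝕜) (A := ConvergentSeries 𝕜 n)
      (M := ConvergentSeries 𝕜 n)) (fun i => D (X i) • pderivDerivation i) Finset.univ) b).trans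
      (Finset.sum_apply _ _ _)
  have sub_eq_zero_of_X := derivation_eq_zero (D - ∑ i, D (X i) • pderivDerivation i) fun j => by
    rw [Derivation.sub_apply, sum_apply, Finset.sum_eq_single j
      (fun i _ hij => by rw [pderiv_X_of_ne hij.symm, mul_zero])
      (fun hj => absurd (Finset.mem_univ j) hj), pderiv_X_self, mul_one, sub_self]
  rw [← sum_apply, ← sub_eq_zero, ← Derivation.sub_apply, sub_eq_zero_of_X]

theorem exists_not_dvd_pderiv [CompleteSpace 𝕜] [CharZero 𝕜] {a : ConvergentSeries 𝕜 n}
    (ha : a ≠ 0) (hu : ¬ IsUnit a) : ∃ i, ¬ a ∣ pderiv i a := by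
  by_contra! h
  exact hu (isUnit_iff.2 (constantCoeff_ne_zero_of_dvd_pderiv (fun h0 => ha (Subtype.ext h0))
    fun i => map_dvd (ConvergentSeries 𝕜 n).val (h i)))

theorem exists_eq_smul_of_mul_pderiv_eq [CharZero 𝕜] {a b : ConvergentSeries 𝕜 n}
    (ha : a ≠ 0) (h : ∀ i, a * pderiv i b = b * pderiv i a) : ∃ c : 𝕜, b = c • a := by
  obtain ⟨c, hc⟩ := _root_.exists_eq_smul_of_mul_pderiv_eq (a := a.1) (b := b.1)
    (fun h0 => ha (Subtype.ext h0)) fun i => congrArg Subtype.val (h i)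
  exact ⟨c, Subtype.ext hc⟩

theorem pderiv_zero_ofPoly (P : Polynomial (ConvergentSeries 𝕜 n)) :
    pderiv 0 (ofPoly P) = ofPoly (Polynomial.derivative P) := by
  refine Subtype.ext (MvPowerSeries.ext fun ν => ?_)
  have cons_add : Finsupp.cons (ν 0) ν.tail + Finsupp.single 0 1 =
      Finsupp.cons (ν 0 + 1) ν.tail := by
    ext i
    cases i using Fin.cases <;> simp [Finsupp.tail_apply]
  rw [pderiv, MvPowerSeries.coeff_pderiv, ← Finsupp.cons_tail ν, cons_add, coeff_cons_ofPoly,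
    coeff_cons_ofPoly, Polynomial.coeff_derivative, Finsupp.cons_zero]
  have mul_eq_smul : P.coeff (ν 0 + 1) * ((ν 0 : ConvergentSeries 𝕜 n) + 1) =
      ((ν 0 : 𝕜) + 1) • P.coeff (ν 0 + 1) := by
    rw [Algebra.smul_def]
    push_cast
    ring
  rw [mul_eq_smul, mul_comm]
  exact (MvPowerSeries.coeff_smul _ _ _).symm

theorem pderiv_zero_liftSucc (a : ConvergentSeries 𝕜 n) : pderiv 0 (liftSucc a) = 0 := by
  rw [← ofPoly_C, pderiv_zero_ofPoly, Polynomial.derivative_C, map_zero]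

theorem pderiv_succ_liftSucc (i : Fin n) (a : ConvergentSeries 𝕜 n) :
    pderiv i.succ (liftSucc a) = liftSucc (pderiv i a) := by
  refine Subtype.ext (MvPowerSeries.ext fun ν => ?_)
  have cons_add : Finsupp.cons (ν 0) ν.tail + Finsupp.single i.succ 1 =
      Finsupp.cons (ν 0) (ν.tail + Finsupp.single i 1) := by
    ext j
    cases j using Fin.cases <;> simp [Finsupp.single_apply, Finsupp.tail_apply]
  rw [pderiv, MvPowerSeries.coeff_pderiv, ← Finsupp.cons_tail ν, cons_add, coeff_cons_liftSucc,
    coeff_cons_liftSucc, Finsupp.cons_succ, pderiv, MvPowerSeries.coeff_pderiv, ite_mul, zero_mul]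

end ConvergentSeries

/-! ### Homogeneous relations modulo a prime -/

section BinaryForm

variable {R A : Type*} [CommRing R] [CommRing A] (φ : R →+* A)

/-- The value `∑ⱼ aⱼ fʲ gᵉ⁻ʲ` at `(f, g)` of the binary form of degree `e` with coefficients
`a₀, …, aₑ`, which are mapped to the ring of `f` and `g` by `φ`. -/
def binaryForm (f g : A) (e : ℕ) (a : ℕ → R) : A :=
  ∑ j ∈ Finset.range (e + 1), φ (a j) * (f ^ j * g ^ (e - j))

variable {φ}

theorem binaryForm_succ_of_eq_zero (f g : A) {e : ℕ} {a : ℕ → R} (ha : a (e + 1) = 0) :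
    binaryForm φ f g (e + 1) a = g * binaryForm φ f g e a := by
  rw [binaryForm, Finset.sum_range_succ, ha, map_zero, zero_mul, add_zero, binaryForm,
    Finset.mul_sum]
  refine Finset.sum_congr rfl fun j hj => ?_
  rw [Nat.succ_sub (Finset.mem_range_succ_iff.1 hj), pow_succ]
  ring

theorem binaryForm_mul_sub_mul (f g : A) (e : ℕ) (b c : R) (a a' : ℕ → R) :
    binaryForm φ f g e (fun j => b * a j - c * a' j) =
      φ b * binaryForm φ f g e a - φ c * binaryForm φ f g e a' := by
  simp only [binaryForm, Finset.mul_sum, ← Finset.sum_sub_distrib]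
  refine Finset.sum_congr rfl fun j _ => ?_
  rw [map_sub, map_mul, map_mul]
  ring

theorem exists_minimal_dvd_binaryForm {h f g : A} (hh : Prime h) (hg : ¬ h ∣ g)
    (hex : ∃ (e : ℕ) (a : ℕ → R), (∃ j ≤ e, a j ≠ 0) ∧ h ∣ binaryForm φ f g e a) :
    ∃ (e : ℕ) (a : ℕ → R), a e ≠ 0 ∧ h ∣ binaryForm φ f g e a ∧
      ∀ b, h ∣ binaryForm φ f g e b → b e = 0 → ∀ j ≤ e, b j = 0 := by
  classical
  obtain ⟨a, ⟨j, hj, haj⟩, ha⟩ := Nat.find_spec hex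
  have minimal (b : ℕ → R) (hb : h ∣ binaryForm φ f g (Nat.find hex) b)
      (hbe : b (Nat.find hex) = 0) : ∀ i ≤ Nat.find hex, b i = 0 := by
    by_contra! hne
    obtain ⟨i, hi, hbi⟩ := hne
    have i_lt : i < Nat.find hex := hi.lt_of_ne fun h => hbi (h ▸ hbe)
    obtain ⟨e, he⟩ := Nat.exists_eq_add_one.2 (i.zero_le.trans_lt i_lt)
    rw [he] at hb hbe i_lt
    rw [binaryForm_succ_of_eq_zero f g hbe] at hb
    exact Nat.find_min hex (he ▸ e.lt_succ_self)
      ⟨b, ⟨i, Nat.lt_succ_iff.1 i_lt, hbi⟩, (hh.dvd_or_dvd hb).resolve_left hg⟩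
  exact ⟨Nat.find hex, a, fun hae => haj (minimal a ha hae j hj), ha, minimal⟩

section Derivation

variable {S : Type*} [CommRing S] [Algebra S A] (D : Derivation S A A) {h f g : A}

theorem dvd_mul_derivation_pow_mul_pow (hD : h ∣ g * D f - f * D g) (j k : ℕ) :
    h ∣ g * D (f ^ j * g ^ k) - (j + k : ℕ) * D g * (f ^ j * g ^ k) := by
  obtain ⟨m, hm⟩ := hD
  have mul_pow_pred (x : A) (i : ℕ) : x * (x ^ (i - 1) * (i : A)) = i * x ^ i := by
    cases i with
    | zero => simp
    | succ i => rw [Nat.add_sub_cancel]; ring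
  refine ⟨m * (j * f ^ (j - 1) * g ^ k), ?_⟩
  rw [Derivation.leibniz, Derivation.leibniz_pow, Derivation.leibniz_pow]
  simp only [smul_eq_mul, nsmul_eq_mul, Nat.cast_add]
  linear_combination (j * f ^ (j - 1) * g ^ k) * hm + (g ^ k * D g) * mul_pow_pred f j +
    (f ^ j * D g) * mul_pow_pred g k

variable {D} {q : A} {d : R → R}

theorem dvd_mul_binaryForm_derivation (hφ : ∀ r, D (φ r) = q * φ (d r)) (hh : h ∣ D h)
    (hfg : h ∣ g * D f - f * D g) {e : ℕ} {a : ℕ → R} (ha : h ∣ binaryForm φ f g e a) :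
    h ∣ q * g * binaryForm φ f g e fun j => d (a j) := by
  have dvd_derivation : h ∣ D (binaryForm φ f g e a) := by
    obtain ⟨m, hm⟩ := ha
    rw [hm, Derivation.leibniz, smul_eq_mul, smul_eq_mul]
    exact dvd_add (dvd_mul_right _ _) (hh.mul_left m)
  have dvd_sub_sub : h ∣ g * D (binaryForm φ f g e a) - e * D g * binaryForm φ f g e a -
      q * g * binaryForm φ f g e fun j => d (a j) := by
    simp only [binaryForm, map_sum, Finset.mul_sum, ← Finset.sum_sub_distrib]
    refine Finset.dvd_sum fun j hj => ?_
    have dvd_monomial := dvd_mul_derivation_pow_mul_pow D hfg j (e - j)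
    rw [Nat.add_sub_cancel' (Finset.mem_range_succ_iff.1 hj)] at dvd_monomial
    convert dvd_monomial.mul_left (φ (a j)) using 1
    rw [Derivation.leibniz, hφ, smul_eq_mul, smul_eq_mul]
    ring
  exact (dvd_sub_right (dvd_sub (dvd_derivation.mul_left g) (ha.mul_left _))).1 dvd_sub_sub

/-- The form with coefficients `aₑ d(aⱼ) - aⱼ d(aₑ)` is divisible by `h` and has no leading term,
so it vanishes by minimality. -/
theorem mul_derivation_eq_of_minimal_dvd_binaryForm (hφ : ∀ r, D (φ r) = q * φ (d r))
    (hh : Prime h) (hhD : h ∣ D h) (hfg : h ∣ g * D f - f * D g) (hq : ¬ h ∣ q) (hg : ¬ h ∣ g)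
    {e : ℕ} {a : ℕ → R} (ha : h ∣ binaryForm φ f g e a)
    (minimal : ∀ b, h ∣ binaryForm φ f g e b → b e = 0 → ∀ j ≤ e, b j = 0) :
    ∀ j ≤ e, a e * d (a j) = a j * d (a e) := by
  intro j hj
  have dvd_derivation := (hh.dvd_or_dvd (dvd_mul_binaryForm_derivation hφ hhD hfg ha)).resolve_left
    fun hqg => (hh.dvd_or_dvd hqg).elim hq hg
  have sub_eq_zero' := minimal (fun j => a e * d (a j) - d (a e) * a j)
    (by
      rw [binaryForm_mul_sub_mul f g e (a e) (d (a e)) (fun j => d (a j)) a]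
      exact dvd_sub (dvd_derivation.mul_left _) (ha.mul_left _))
    (by ring) j hj
  linear_combination sub_eq_zero'

end Derivation

theorem map_binaryForm {B : Type*} [CommRing B] (π : A →+* B) (f g : A) (e : ℕ) (a : ℕ → R) :
    π (binaryForm φ f g e a) = binaryForm (π.comp φ) (π f) (π g) e a := by
  simp only [binaryForm, map_sum, map_mul, map_pow, RingHom.comp_apply]

theorem isAlgebraic_div_of_binaryForm_eq_zero {𝕜 K : Type*} [Field 𝕜] [Field K] [Algebra 𝕜 K]
    {x y : K} (hy : y ≠ 0) {e : ℕ} {c : ℕ → 𝕜} (hc : c e ≠ 0)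
    (h : binaryForm (algebraMap 𝕜 K) x y e c = 0) : IsAlgebraic 𝕜 (x / y) := by
  refine ⟨∑ j ∈ Finset.range (e + 1), Polynomial.monomial j (c j), fun h0 => hc ?_, ?_⟩
  · simpa [Polynomial.finsetSum_coeff, Polynomial.coeff_monomial] using
      congrArg (fun p => Polynomial.coeff p e) h0
  · have mul_eq_binaryForm : Polynomial.aeval (x / y)
        (∑ j ∈ Finset.range (e + 1), Polynomial.monomial j (c j)) * y ^ e =
          binaryForm (algebraMap 𝕜 K) x y e c := by
      rw [map_sum, Finset.sum_mul]
      refine Finset.sum_congr rfl fun j hj => ?_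
      rw [Polynomial.aeval_monomial, mul_assoc, div_pow,
        ← pow_mul_pow_sub y (Finset.mem_range_succ_iff.1 hj), ← mul_assoc (x ^ j / y ^ j),
        div_mul_cancel₀ _ (pow_ne_zero j hy)]
    exact (mul_eq_zero.1 (mul_eq_binaryForm.trans h)).resolve_right (pow_ne_zero e hy)

theorem exists_dvd_sub_smul_of_dvd_binaryForm {𝕜 : Type*} [Field 𝕜] [IsAlgClosed 𝕜] [Algebra 𝕜 A]
    {h f g : A} (hh : Prime h) (hg : ¬ h ∣ g) {e : ℕ} {c : ℕ → 𝕜} (hc : c e ≠ 0)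
    (hd : h ∣ binaryForm (algebraMap 𝕜 A) f g e c) : ∃ z : 𝕜, h ∣ f - z • g := by
  have : (Ideal.span {h}).IsPrime := (Ideal.span_singleton_prime hh.ne_zero).2 hh
  let K := FractionRing (A ⧸ Ideal.span {h})
  let π : A →ₐ[𝕜] K :=
    (IsScalarTower.toAlgHom 𝕜 (A ⧸ Ideal.span {h}) K).comp (Ideal.Quotient.mkₐ 𝕜 (Ideal.span {h}))
  have π_eq_zero_iff (x : A) : π x = 0 ↔ h ∣ x := by
    change algebraMap (A ⧸ Ideal.span {h}) K (Ideal.Quotient.mk _ x) = 0 ↔ _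
    rw [IsFractionRing.to_map_eq_zero_iff, Ideal.Quotient.eq_zero_iff_mem,
      Ideal.mem_span_singleton]
  have π_g_ne_zero : π g ≠ 0 := fun h0 => hg ((π_eq_zero_iff g).1 h0)
  have form_eq_zero : binaryForm (algebraMap 𝕜 K) (π f) (π g) e c = 0 := by
    rw [← π.comp_algebraMap, ← (π_eq_zero_iff _).2 hd]
    exact (map_binaryForm π.toRingHom f g e c).symm
  have algebraic := isAlgebraic_div_of_binaryForm_eq_zero π_g_ne_zero hc form_eq_zero
  obtain ⟨z, hz⟩ := minpoly.mem_range_of_degree_eq_one 𝕜 _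
    (IsAlgClosed.degree_eq_one_of_irreducible 𝕜 (minpoly.irreducible algebraic.isIntegral))
  refine ⟨z, (π_eq_zero_iff _).1 ?_⟩
  rw [map_sub, map_smul, Algebra.smul_def, hz, div_mul_cancel₀ _ π_g_ne_zero, sub_self]

end BinaryForm

theorem exists_sum_range_C_mul_eq_zero {R : Type*} [CommRing R] [Nontrivial R] {d : ℕ}
    {r : ℕ → Polynomial R} (hr : ∀ j, (r j).degree < d) :
    ∃ a : ℕ → R, (∃ j ≤ d, a j ≠ 0) ∧
      ∑ j ∈ Finset.range (d + 1), Polynomial.C (a j) * r j = 0 := by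
  let v (j : Fin (d + 1)) : Fin d → R := fun k => (r j).coeff k
  have not_linearIndependent : ¬ LinearIndependent R v := fun hv => by
    simpa using hv.fintype_card_le_finrank
  obtain ⟨c, hc, j, hj⟩ := Fintype.not_linearIndependent_iff.1 not_linearIndependent
  refine ⟨fun j => c (Fin.ofNat (d + 1) j), ⟨j, Fin.is_le j, by simpa using hj⟩, ?_⟩
  ext k : 1
  rw [Finset.sum_range, Polynomial.finsetSum_coeff, Polynomial.coeff_zero]
  rcases lt_or_ge k d with hk | hk
  · simpa [v, Finset.sum_apply] using congrFun hc ⟨k, hk⟩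
  · refine Finset.sum_eq_zero fun j _ => ?_
    rw [Polynomial.coeff_C_mul, Polynomial.coeff_eq_zero_of_degree_lt, mul_zero]
    exact (hr j).trans_le (by exact_mod_cast hk)

namespace ConvergentSeries

section Weierstrass

variable {𝕜 : Type*} [NontriviallyNormedField 𝕜] [CompleteSpace 𝕜] {n : ℕ}
  {P : Polynomial (ConvergentSeries 𝕜 n)}

theorem IsWeierstrass.exists_dvd_binaryForm (hP : IsWeierstrass P)
    (f g : ConvergentSeries 𝕜 (n + 1)) :
    ∃ (e : ℕ) (a : ℕ → ConvergentSeries 𝕜 n), (∃ j ≤ e, a j ≠ 0) ∧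
      ofPoly P ∣ binaryForm liftSucc.toRingHom f g e a := by
  choose q r hr hqr using fun j =>
    hP.isRegularOfOrder.exists_eq_mul_add (f ^ j * g ^ (P.natDegree - j))
  obtain ⟨a, ha, sum_eq_zero⟩ := exists_sum_range_C_mul_eq_zero hr
  refine ⟨P.natDegree, a, ha, ?_⟩
  have term_eq (j : ℕ) : liftSucc (a j) * (f ^ j * g ^ (P.natDegree - j)) =
      ofPoly P * (liftSucc (a j) * q j) + ofPoly (Polynomial.C (a j) * r j) := by
    rw [hqr, map_mul, ofPoly_C]
    ring
  have binaryForm_eq : binaryForm liftSucc.toRingHom f g P.natDegree a =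
      ∑ j ∈ Finset.range (P.natDegree + 1), ofPoly P * (liftSucc (a j) * q j) := by
    refine (Finset.sum_congr rfl fun j _ => term_eq j).trans ?_
    rw [Finset.sum_add_distrib, ← map_sum, sum_eq_zero, map_zero, add_zero]
  rw [binaryForm_eq]
  exact Finset.dvd_sum fun j _ => dvd_mul_right _ _

theorem IsWeierstrass.natDegree_pos {𝕜 : Type*} [NormedField 𝕜]
    {P : Polynomial (ConvergentSeries 𝕜 n)} (hP : IsWeierstrass P) (hu : ¬ IsUnit (ofPoly P)) :
    0 < P.natDegree := by
  refine Nat.pos_of_ne_zero fun h => hu ?_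
  rw [hP.monic.natDegree_eq_zero.1 h, map_one]
  exact isUnit_one

theorem IsWeierstrass.not_dvd_liftSucc (hP : IsWeierstrass P) (hd : 0 < P.natDegree)
    {a : ConvergentSeries 𝕜 n} (ha : a ≠ 0) : ¬ ofPoly P ∣ liftSucc a := by
  rw [← ofPoly_C]
  intro h
  exact ha (Polynomial.C_eq_zero.1
    (Polynomial.eq_zero_of_dvd_of_natDegree_lt (hP.dvd_of_ofPoly_dvd h) (by simpa using hd)))

theorem IsWeierstrass.not_dvd_pderiv_zero [CharZero 𝕜] (hP : IsWeierstrass P)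
    (hd : 0 < P.natDegree) : ¬ ofPoly P ∣ pderiv 0 (ofPoly P) := by
  rw [pderiv_zero_ofPoly]
  intro h
  have derivative_eq_zero := Polynomial.eq_zero_of_dvd_of_natDegree_lt (hP.dvd_of_ofPoly_dvd h)
    (Polynomial.natDegree_derivative_lt hd.ne')
  have : CharZero (ConvergentSeries 𝕜 n) := algebraRat.charZero _
  exact hd.ne' (Polynomial.derivative_eq_zero.1 derivative_eq_zero)

variable [CharZero 𝕜] {f g : ConvergentSeries 𝕜 (n + 1)}

/-- The derivations `∂₀h ∂ᵢ - ∂ᵢh ∂₀`, where `h` is the Weierstrass polynomial, kill `h`; hence a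
homogeneous relation of minimal degree between `f` and `g` modulo `h` is constant up to a factor. -/
theorem IsWeierstrass.exists_dvd_binaryForm_algebraMap (hP : IsWeierstrass P)
    (hh : Prime (ofPoly P)) (hg : ¬ ofPoly P ∣ g)
    (hfg : ∀ D : Derivation 𝕜 (ConvergentSeries 𝕜 (n + 1)) (ConvergentSeries 𝕜 (n + 1)),
      ofPoly P ∣ g * D f - f * D g) :
    ∃ (e : ℕ) (c : ℕ → 𝕜), c e ≠ 0 ∧ ofPoly P ∣ binaryForm (algebraMap 𝕜 _) f g e c := by
  have natDegree_pos := hP.natDegree_pos hh.not_isUnit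
  obtain ⟨e, a, hae, ha, minimal⟩ := exists_minimal_dvd_binaryForm hh hg
    (hP.exists_dvd_binaryForm f g)
  have proportional : ∀ j ≤ e, ∃ c : 𝕜, a j = c • a e := by
    refine fun j hj => exists_eq_smul_of_mul_pderiv_eq hae fun i => ?_
    let δ : Derivation 𝕜 (ConvergentSeries 𝕜 (n + 1)) (ConvergentSeries 𝕜 (n + 1)) :=
      pderiv 0 (ofPoly P) • pderivDerivation i.succ - pderiv i.succ (ofPoly P) • pderivDerivation 0
    have δ_apply (x) : δ x =
        pderiv 0 (ofPoly P) * pderiv i.succ x - pderiv i.succ (ofPoly P) * pderiv 0 x := rfl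
    refine mul_derivation_eq_of_minimal_dvd_binaryForm (D := δ) (fun r => ?_) hh ?_ (hfg δ)
      (hP.not_dvd_pderiv_zero natDegree_pos) hg ha minimal j hj
    · exact (δ_apply (liftSucc r)).trans
        (by rw [pderiv_zero_liftSucc, pderiv_succ_liftSucc, mul_zero, sub_zero]; rfl)
    · rw [δ_apply, mul_comm, sub_self]
      exact dvd_zero _
  choose! c hc using proportional
  refine ⟨e, c, fun h => hae (by rw [hc e le_rfl, h, zero_smul]), ?_⟩
  have binaryForm_eq : binaryForm liftSucc.toRingHom f g e a =
      liftSucc (a e) * binaryForm (algebraMap 𝕜 _) f g e c := by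
    rw [binaryForm, binaryForm, Finset.mul_sum]
    refine Finset.sum_congr rfl fun j hj => ?_
    have liftSucc_eq : liftSucc (a j) = c j • liftSucc (a e) := by
      rw [hc j (Finset.mem_range_succ_iff.1 hj), map_smul]
    rw [← Algebra.smul_def, mul_smul_comm, ← smul_mul_assoc]
    exact congrArg (· * (f ^ j * g ^ (e - j))) liftSucc_eq
  rw [binaryForm_eq] at ha
  exact (hh.dvd_or_dvd ha).resolve_left (hP.not_dvd_liftSucc natDegree_pos hae)

end Weierstrass

theorem dvd_wronskian_derivation {𝕜 : Type*} [NormedField 𝕜] {n : ℕ}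
    {h f g : ConvergentSeries 𝕜 n} (hfg : ∀ i, h ∣ g * pderiv i f - f * pderiv i g)
    (D : Derivation 𝕜 (ConvergentSeries 𝕜 n) (ConvergentSeries 𝕜 n)) :
    h ∣ g * D f - f * D g := by
  rw [derivation_eq_sum D f, derivation_eq_sum D g, Finset.mul_sum, Finset.mul_sum,
    ← Finset.sum_sub_distrib]
  refine Finset.dvd_sum fun i _ => ?_
  convert (hfg i).mul_left (D (X i)) using 1
  ring

theorem exists_dvd_sub_smul {𝕜 : Type*} [NontriviallyNormedField 𝕜] [CompleteSpace 𝕜] [CharZero 𝕜]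
    [IsAlgClosed 𝕜] : ∀ {n : ℕ} {h f g : ConvergentSeries 𝕜 n}, Prime h → ¬ h ∣ g →
    (∀ i, h ∣ g * pderiv i f - f * pderiv i g) → ∃ z : 𝕜, h ∣ f - z • g
  | 0, h, f, g, hh, _, _ => by
    refine absurd (isUnit_iff.2 fun evalZero_eq_zero => hh.ne_zero ?_) hh.not_isUnit
    refine Subtype.ext (MvPowerSeries.ext fun ν => ?_)
    rw [Subsingleton.elim ν 0]
    exact evalZero_eq_zero
  | n + 1, h, f, g, hh, hg, hfg => by
    obtain ⟨p, hp, d, regular⟩ := exists_shear_isRegularOfOrder hh.ne_zero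
    obtain ⟨P, hP, -, associated⟩ := regular.exists_associated_ofPoly
    have ofPoly_dvd_iff (x) : ofPoly P ∣ shear p hp x ↔ h ∣ x := by
      rw [associated.dvd_iff_dvd_left]
      exact map_dvd_iff (shear p hp)
    have prime_ofPoly : Prime (ofPoly P) :=
      associated.symm.prime ((MulEquiv.prime_iff (shear p hp).toMulEquiv).2 hh)
    have not_dvd : ¬ ofPoly P ∣ shear p hp g := by rwa [ofPoly_dvd_iff]
    have dvd_wronskian
        (D : Derivation 𝕜 (ConvergentSeries 𝕜 (n + 1)) (ConvergentSeries 𝕜 (n + 1))) :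
        ofPoly P ∣ shear p hp g * D (shear p hp f) - shear p hp f * D (shear p hp g) := by
      let E : Derivation 𝕜 (ConvergentSeries 𝕜 (n + 1)) (ConvergentSeries 𝕜 (n + 1)) :=
        Derivation.mk'
          ((shear p hp).symm.toLinearMap ∘ₗ (D : _ →ₗ[𝕜] _) ∘ₗ (shear p hp).toLinearMap)
          fun a b => by simp
      have shear_E (x) : shear p hp (E x) = D (shear p hp x) := (shear p hp).apply_symm_apply _
      rw [← shear_E, ← shear_E, ← map_mul, ← map_mul, ← map_sub, ofPoly_dvd_iff]
      exact dvd_wronskian_derivation hfg E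
    obtain ⟨e, c, hc, hsum⟩ :=
      hP.exists_dvd_binaryForm_algebraMap prime_ofPoly not_dvd dvd_wronskian
    obtain ⟨z, hz⟩ := exists_dvd_sub_smul_of_dvd_binaryForm prime_ofPoly not_dvd hc hsum
    exact ⟨z, (ofPoly_dvd_iff _).1 (by rwa [map_sub, map_smul])⟩

end ConvergentSeries

section Wronskian

theorem dvd_smul_iff_of_ne_zero {𝕜 A : Type*} [Field 𝕜] [CommRing A] [Algebra 𝕜 A] {c : 𝕜}
    (hc : c ≠ 0) {a b : A} : a ∣ c • b ↔ a ∣ b :=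
  ⟨fun h => by simpa [smul_smul, hc] using dvd_smul_of_dvd c⁻¹ h, dvd_smul_of_dvd c⟩

theorem dvd_iff_dvd_of_dvd_sub_smul {𝕜 A : Type*} [Field 𝕜] [CommRing A] [Algebra 𝕜 A] {c : 𝕜}
    (hc : c ≠ 0) {h f g : A} (hd : h ∣ f - c • g) : h ∣ f ↔ h ∣ g := by
  rw [← dvd_smul_iff_of_ne_zero hc (b := g)]
  exact ⟨fun hf => (dvd_sub_right hf).1 hd, fun hg => (dvd_sub_left hg).1 hd⟩

theorem isUnit_natCast_of_ne_zero (𝕜 A : Type*) [Field 𝕜] [CharZero 𝕜] [CommRing A]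
    [Algebra 𝕜 A] {k : ℕ} (hk : k ≠ 0) : IsUnit (k : A) := by
  simpa using (Nat.cast_ne_zero (R := 𝕜).2 hk).isUnit.map (algebraMap 𝕜 A)

variable {R A : Type*} [CommRing R] [CommRing A] [Algebra R A] (D : Derivation R A A)

theorem wronskian_sub_smul (f g : A) (c : R) :
    g * D (f - c • g) - (f - c • g) * D g = g * D f - f * D g := by
  rw [map_sub, D.map_smul, mul_sub, sub_mul, mul_smul_comm, smul_mul_assoc]
  ring

theorem derivation_pow_succ (h : A) (k : ℕ) : D (h ^ (k + 1)) = (k + 1 : ℕ) * (h ^ k * D h) := by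
  rw [D.leibniz_pow, Nat.add_sub_cancel, smul_eq_mul, nsmul_eq_mul]

theorem pow_dvd_wronskian (g : A) {h e : A} {m : ℕ} (he : h ^ (m + 1) ∣ e) :
    h ^ m ∣ g * D e - e * D g := by
  obtain ⟨s, rfl⟩ := he
  rw [Derivation.leibniz, derivation_pow_succ, smul_eq_mul, smul_eq_mul]
  exact ⟨g * (h * D s + s * ((m + 1 : ℕ) * D h)) - h * s * D g, by ring⟩

theorem pow_succ_dvd_of_pow_dvd_wronskian {𝕜 B : Type*} [Field 𝕜] [CharZero 𝕜] [CommRing B]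
    [IsCancelMulZero B] [Algebra 𝕜 B] {D : Derivation 𝕜 B B} {g h e : B} (hh : Prime h)
    (hhD : ¬ h ∣ D h) (hg : ¬ h ∣ g) (he : h ∣ e) {m : ℕ} (hd : h ^ m ∣ g * D e - e * D g) :
    h ^ (m + 1) ∣ e := by
  induction m with
  | zero => simpa using he
  | succ m ih =>
    obtain ⟨s, hs⟩ := ih ((pow_dvd_pow h m.le_succ).trans hd)
    have wronskian_eq : g * D e - e * D g =
        h ^ m * ((m + 1 : ℕ) * (g * s * D h)) + h ^ (m + 1) * (g * D s - s * D g) := by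
      rw [hs, Derivation.leibniz, derivation_pow_succ, smul_eq_mul, smul_eq_mul]
      ring
    rw [wronskian_eq, dvd_add_left (dvd_mul_right _ _), pow_succ,
      mul_dvd_mul_iff_left (pow_ne_zero m hh.ne_zero),
      (isUnit_natCast_of_ne_zero 𝕜 B m.succ_ne_zero).dvd_mul_left] at hd
    obtain ⟨t, rfl⟩ := (hh.dvd_or_dvd ((hh.dvd_or_dvd hd).resolve_right hhD)).resolve_left hg
    exact ⟨t, by rw [hs]; ring⟩

variable {D}

theorem prod_mul_derivation_prod_pow {ι : Type*} [DecidableEq ι] (s : Finset ι) (x : ι → A)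
    (m : ι → ℕ) :
    (∏ j ∈ s, x j) * D (∏ j ∈ s, x j ^ m j) =
      (∏ j ∈ s, x j ^ m j) * ∑ i ∈ s, m i * (∏ j ∈ s.erase i, x j) * D (x i) := by
  induction s using Finset.induction_on with
  | empty => simp
  | insert a s ha ih =>
    have sum_erase_insert : ∑ i ∈ s, (m i : A) * (∏ j ∈ (insert a s).erase i, x j) * D (x i) =
        x a * ∑ i ∈ s, m i * (∏ j ∈ s.erase i, x j) * D (x i) := by
      rw [Finset.mul_sum]
      refine Finset.sum_congr rfl fun i hi => ?_
      have a_ne : a ≠ i := fun h => ha (h ▸ hi)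
      rw [Finset.erase_insert_of_ne a_ne, Finset.prod_insert (mt Finset.mem_of_mem_erase ha)]
      ring
    have mul_pow_pred : x a * ((m a : A) * x a ^ (m a - 1)) = m a * x a ^ m a := by
      cases m a with
      | zero => simp
      | succ k => rw [Nat.add_sub_cancel]; ring
    rw [Finset.prod_insert ha, Finset.prod_insert ha, Finset.sum_insert ha, sum_erase_insert,
      Finset.erase_insert ha, Derivation.leibniz, Derivation.leibniz_pow]
    simp only [smul_eq_mul, nsmul_eq_mul]
    linear_combination (x a * x a ^ m a) * ih +
      ((∏ j ∈ s, x j) * (∏ j ∈ s, x j ^ m j) * D (x a)) * mul_pow_pred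

end Wronskian

namespace ConvergentSeries

variable {n : ℕ}

theorem pow_dvd_wronskian_of_pow_succ_dvd_sub_smul {𝕜 : Type*} [NormedField 𝕜]
    {f g h : ConvergentSeries 𝕜 n} {c : 𝕜} {m : ℕ} (hd : h ^ (m + 1) ∣ f - c • g) (i : Fin n) :
    h ^ m ∣ g * pderiv i f - f * pderiv i g := by
  have hw := pow_dvd_wronskian (pderivDerivation i) g hd
  rwa [wronskian_sub_smul] at hw

theorem pow_succ_dvd_sub_smul_of_pow_dvd_wronskian {𝕜 : Type*} [NormedField 𝕜] [CompleteSpace 𝕜]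
    [CharZero 𝕜] {f g h : ConvergentSeries 𝕜 n} (hh : Prime h) (hg : ¬ h ∣ g) {c : 𝕜}
    (hc : h ∣ f - c • g) {m : ℕ} (hd : ∀ i, h ^ m ∣ g * pderiv i f - f * pderiv i g) :
    h ^ (m + 1) ∣ f - c • g := by
  obtain ⟨i, hi⟩ := exists_not_dvd_pderiv hh.ne_zero hh.not_isUnit
  have hw := hd i
  simp only [← pderivDerivation_apply] at hi hw
  rw [← wronskian_sub_smul (pderivDerivation i) f g c] at hw
  exact pow_succ_dvd_of_pow_dvd_wronskian hh hi hg hc hw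

/-! ### The one-form of a meromorphic function -/

namespace IrredDecomp

section NormedField

variable {𝕜 : Type*} [NormedField 𝕜] {f g : ConvergentSeries 𝕜 n}
  (F : IrredDecomp f) (G : IrredDecomp g)

theorem redLogDeriv_apply (k : Fin n) :
    F.redLogDeriv k = F.red * (↑F.u⁻¹ : ConvergentSeries 𝕜 n) *
        pderiv k (F.u : ConvergentSeries 𝕜 n) +
      ∑ i, F.exponent i * (∏ j ∈ Finset.univ.erase i, F.factor j) * pderiv k (F.factor i) := by
  simp only [redLogDeriv, Pi.add_apply, Pi.smul_apply, Finset.sum_apply, smul_eq_mul]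
  rfl

theorem theta_apply (k : Fin n) :
    F.theta G k = G.red * F.redLogDeriv k - F.red * G.redLogDeriv k := rfl

theorem theta_swap (k : Fin n) : F.theta G k = -G.theta F k := by
  rw [theta_apply, theta_apply, neg_sub]

theorem mul_redLogDeriv (k : Fin n) : f * F.redLogDeriv k = F.red * pderiv k f := by
  have prod_mul := prod_mul_derivation_prod_pow (D := pderivDerivation k) Finset.univ F.factor
    F.exponent
  simp only [pderivDerivation_apply] at prod_mul
  rw [redLogDeriv_apply]
  nth_rewrite 1 [F.eq_prod]
  rw [congrArg (pderiv k) F.eq_prod, pderiv_mul, red]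
  linear_combination (-(F.u : ConvergentSeries 𝕜 n)) * prod_mul +
    ((∏ i, F.factor i ^ F.exponent i) * (∏ i, F.factor i) *
      pderiv k (F.u : ConvergentSeries 𝕜 n)) * F.u.mul_inv

theorem mul_theta (k : Fin n) :
    f * g * F.theta G k = F.red * G.red * (g * pderiv k f - f * pderiv k g) := by
  rw [theta_apply]
  linear_combination (g * G.red) * F.mul_redLogDeriv k - (f * F.red) * G.mul_redLogDeriv k

theorem red_dvd : F.red ∣ f := by
  nth_rewrite 2 [F.eq_prod]
  exact (Finset.prod_dvd_prod_of_dvd _ _ fun i _ =>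
    dvd_pow_self _ (Nat.one_le_iff_ne_zero.1 (F.exponent_pos i))).mul_left _

variable {F G} {h : ConvergentSeries 𝕜 n}

theorem pow_dvd_theta_iff (hh : Prime h) (hf : ¬ h ∣ f) (hg : ¬ h ∣ g) (m : ℕ) (k : Fin n) :
    h ^ m ∣ F.theta G k ↔ h ^ m ∣ g * pderiv k f - f * pderiv k g := by
  have not_dvd_red : ¬ h ∣ F.red * G.red := fun hd => (hh.dvd_or_dvd hd).elim
    (fun hd => hf (hd.trans F.red_dvd)) fun hd => hg (hd.trans G.red_dvd)
  have not_dvd_mul : ¬ h ∣ f * g := fun hd => (hh.dvd_or_dvd hd).elim hf hg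
  constructor <;> intro hd
  · refine hh.pow_dvd_of_dvd_mul_left m not_dvd_red ?_
    rw [← F.mul_theta G k]
    exact hd.mul_left _
  · refine hh.pow_dvd_of_dvd_mul_left m not_dvd_mul ?_
    rw [F.mul_theta G k]
    exact hd.mul_left _

theorem exists_associated_factor (hh : Prime h) (hf : h ∣ f) :
    ∃ i, Associated h (F.factor i) := by
  rw [F.eq_prod, F.u.isUnit.dvd_mul_left, hh.dvd_finsetProd_iff] at hf
  obtain ⟨i, -, hi⟩ := hf
  exact ⟨i, hh.irreducible.associated_of_dvd (F.irreducible_factor i) (hh.dvd_of_dvd_pow hi)⟩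

theorem not_dvd_prod_erase (hh : Prime h) {i : Fin F.α} (hi : Associated h (F.factor i)) :
    ¬ h ∣ ∏ j ∈ Finset.univ.erase i, F.factor j := by
  rw [hh.dvd_finsetProd_iff]
  rintro ⟨j, hj, hd⟩
  exact F.not_associated j i (Finset.ne_of_mem_erase hj)
    ((hh.irreducible.associated_of_dvd (F.irreducible_factor j) hd).symm.trans hi)

variable [CompleteSpace 𝕜] [CharZero 𝕜]

theorem exists_not_dvd_redLogDeriv (hh : Prime h) (hf : h ∣ f) :
    ∃ k, ¬ h ∣ F.redLogDeriv k := by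
  obtain ⟨i, hi⟩ := F.exists_associated_factor hh hf
  obtain ⟨k, hk⟩ := exists_not_dvd_pderiv (F.irreducible_factor i).ne_zero
    (F.irreducible_factor i).not_isUnit
  refine ⟨k, fun hd => hk ?_⟩
  rw [← hi.dvd_iff_dvd_left]
  have dvd_red : h ∣ F.red := hi.dvd.trans (Finset.dvd_prod_of_mem _ (Finset.mem_univ i))
  have dvd_others : h ∣ ∑ l ∈ Finset.univ.erase i,
      F.exponent l * (∏ j ∈ Finset.univ.erase l, F.factor j) * pderiv k (F.factor l) :=
    Finset.dvd_sum fun l hl => ((hi.dvd.trans (Finset.dvd_prod_of_mem _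
      (Finset.mem_erase.2 ⟨(Finset.ne_of_mem_erase hl).symm, Finset.mem_univ i⟩))).mul_left
        _).mul_right _
  have exponent_ne_zero : F.exponent i ≠ 0 := Nat.one_le_iff_ne_zero.1 (F.exponent_pos i)
  rw [redLogDeriv_apply, dvd_add_right ((dvd_red.mul_right _).mul_right _),
    ← Finset.add_sum_erase _ _ (Finset.mem_univ i), dvd_add_left dvd_others, mul_assoc,
    (isUnit_natCast_of_ne_zero 𝕜 _ exponent_ne_zero).dvd_mul_left] at hd
  exact (hh.dvd_or_dvd hd).resolve_left (not_dvd_prod_erase hh hi)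

theorem exists_not_dvd_theta (hh : Prime h) (hf : h ∣ f) (hg : ¬ h ∣ g) :
    ∃ k, ¬ h ∣ F.theta G k := by
  obtain ⟨k, hk⟩ := F.exists_not_dvd_redLogDeriv hh hf
  obtain ⟨i, hi⟩ := F.exists_associated_factor hh hf
  have dvd_red : h ∣ F.red := hi.dvd.trans (Finset.dvd_prod_of_mem _ (Finset.mem_univ i))
  refine ⟨k, fun hd => ?_⟩
  rw [theta_apply, dvd_sub_left (dvd_red.mul_right _)] at hd
  exact (hh.dvd_or_dvd hd).elim (fun hG => hg (hG.trans G.red_dvd)) hk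

theorem not_dvd_of_dvd_theta (hfg : IsRelPrime f g) (hh : Prime h)
    (hd : ∀ k, h ∣ F.theta G k) : ¬ h ∣ f ∧ ¬ h ∣ g := by
  have not_dvd_f : ¬ h ∣ f := fun hf => by
    obtain ⟨k, hk⟩ := exists_not_dvd_theta (F := F) (G := G) hh hf
      fun hg => hh.not_isUnit (hfg hf hg)
    exact hk (hd k)
  refine ⟨not_dvd_f, fun hg => ?_⟩
  obtain ⟨k, hk⟩ := exists_not_dvd_theta (F := G) (G := F) hh hg not_dvd_f
  rw [theta_swap] at hk
  exact hk (hd k).neg_right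

end NormedField

end IrredDecomp

theorem IsSingAlg.dvd_iff {𝕜 : Type*} [NormedField 𝕜] {ω : OneForm 𝕜 n}
    {s : ConvergentSeries 𝕜 n} (hs : IsSingAlg ω s) (e : ConvergentSeries 𝕜 n) :
    e ∣ s ↔ ∀ k, e ∣ ω k :=
  ⟨fun he k => he.trans (hs.1 k), hs.2 e⟩

section NontriviallyNormedField

variable {𝕜 : Type*} [NontriviallyNormedField 𝕜] [CompleteSpace 𝕜]

theorem exists_isSingAlg (ω : OneForm 𝕜 n) : ∃ s, IsSingAlg ω s := by
  classical
  let _ := UniqueFactorizationMonoid.strongNormalizationMonoid (α := ConvergentSeries 𝕜 n)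
  let _ := UniqueFactorizationMonoid.toNormalizedGCDMonoid (ConvergentSeries 𝕜 n)
  exact ⟨Finset.univ.gcd ω, fun k => Finset.gcd_dvd (Finset.mem_univ k),
    fun e he => Finset.dvd_gcd fun k _ => he k⟩

theorem isSingAlgComponent_iff {ω : OneForm 𝕜 n} {h : ConvergentSeries 𝕜 n} {l : ℕ} :
    IsSingAlgComponent ω h l ↔
      Irreducible h ∧ 1 ≤ l ∧ IsGreatest {m | ∀ k, h ^ m ∣ ω k} l := by
  refine and_congr_right fun _ => and_congr_right fun _ => ⟨?_, fun hl => ?_⟩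
  · rintro ⟨s, hs, hd, hnd⟩
    refine ⟨(hs.dvd_iff _).1 hd, fun m hm => ?_⟩
    by_contra! hlt
    exact hnd ((pow_dvd_pow h hlt).trans ((hs.dvd_iff _).2 hm))
  · obtain ⟨s, hs⟩ := exists_isSingAlg ω
    refine ⟨s, hs, (hs.dvd_iff _).2 hl.1, fun hd => ?_⟩
    exact l.not_succ_le_self (hl.2 ((hs.dvd_iff _).1 hd))

end NontriviallyNormedField

end ConvergentSeries

theorem IsConvergentSeries.of_norm_coeff_le {𝕜 𝕜' : Type*} [NormedField 𝕜] [NormedField 𝕜'] {n : ℕ}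
    {a : MvPowerSeries (Fin n) 𝕜} {b : MvPowerSeries (Fin n) 𝕜'} (ha : IsConvergentSeries a)
    (h : ∀ ν, ‖MvPowerSeries.coeff ν b‖ ≤ ‖MvPowerSeries.coeff ν a‖) : IsConvergentSeries b := by
  obtain ⟨r, hr, hs⟩ := ha
  exact ⟨r, hr, hs.of_nonneg_of_le (fun ν => by positivity)
    fun ν => mul_le_mul_of_nonneg_right (h ν) (by positivity)⟩

namespace ConvergentSeries

/-! ### Square roots and complexification -/

section SquareRoot

variable {𝕜 : Type*} [NormedField 𝕜] [CompleteSpace 𝕜] {n : ℕ}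

-- `(X + w₀)² - v` is regular of order `1`, so Weierstrass preparation splits off a linear factor.
theorem isSquare_of_isSquare_evalZero [NeZero (2 : 𝕜)] {v : ConvergentSeries 𝕜 n} (hv : IsUnit v)
    (hsq : IsSquare (evalZero v)) : IsSquare v := by
  obtain ⟨w₀, hw₀⟩ := hsq
  have w₀_ne : w₀ ≠ 0 := fun h0 => isUnit_iff.1 hv (by rw [hw₀, h0, zero_mul])
  set Q : Polynomial (ConvergentSeries 𝕜 n) :=
    (Polynomial.X + Polynomial.C (algebraMap 𝕜 _ w₀)) ^ 2 - Polynomial.C v with hQ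
  have map_Q : Q.map (evalZero : _ →ₐ[𝕜] 𝕜).toRingHom =
      Polynomial.X ^ 2 + Polynomial.C (2 * w₀) * Polynomial.X := by
    simp only [hQ, Polynomial.map_sub, Polynomial.map_pow, Polynomial.map_add, Polynomial.map_X,
      Polynomial.map_C, AlgHom.toRingHom_eq_coe, RingHom.coe_coe, AlgHom.commutes,
      Algebra.algebraMap_self_apply, hw₀, map_mul, map_ofNat]
    ring
  have regular : IsRegularOfOrder 1 (ofPoly Q) := by
    rw [IsRegularOfOrder, PowerSeries.order_eq_nat, axis_ofPoly, map_Q]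
    refine ⟨by simp [w₀_ne, two_ne_zero], fun i hi => ?_⟩
    obtain rfl : i = 0 := by omega
    simp
  obtain ⟨P, hP, hdeg, hass⟩ := regular.exists_associated_ofPoly
  have root : Q.eval (-P.coeff 0) = 0 := by
    refine Polynomial.eval_eq_zero_of_dvd_of_eval_eq_zero (hP.dvd_of_ofPoly_dvd hass.dvd) ?_
    rw [hP.monic.eq_X_add_C hdeg]
    simp
  refine ⟨-P.coeff 0 + algebraMap 𝕜 _ w₀, ?_⟩
  simp only [hQ, Polynomial.eval_sub, Polynomial.eval_pow, Polynomial.eval_add,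
    Polynomial.eval_X, Polynomial.eval_C] at root
  rw [← sq, sub_eq_zero.1 root]

theorem exists_eq_sq_or_eq_neg_sq {n : ℕ} {v : ConvergentSeries ℝ n} (hv : IsUnit v) :
    ∃ w, v = w ^ 2 ∨ v = -w ^ 2 := by
  rcases (isUnit_iff.1 hv).lt_or_gt with hneg | hpos
  · obtain ⟨w, hw⟩ := isSquare_of_isSquare_evalZero hv.neg
      (by rw [map_neg, Real.isSquare_iff]; exact neg_nonneg.2 hneg.le)
    exact ⟨w, .inr (by rw [sq, ← hw, neg_neg])⟩
  · obtain ⟨w, hw⟩ := isSquare_of_isSquare_evalZero hv (Real.isSquare_iff.2 hpos.le)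
    exact ⟨w, .inl (by rw [sq, ← hw])⟩

end SquareRoot

variable {n : ℕ}

/-- The homomorphism `𝕜{x} → 𝕜'{x}` which applies a norm-nonincreasing ring homomorphism to the
coefficients of a series. -/
noncomputable def mapCoeff {𝕜 𝕜' : Type*} [NormedField 𝕜] [NormedField 𝕜'] (φ : 𝕜 →+* 𝕜')
    (hφ : ∀ x, ‖φ x‖ ≤ ‖x‖) : ConvergentSeries 𝕜 n →+* ConvergentSeries 𝕜' n :=
  ((MvPowerSeries.map φ).comp (ConvergentSeries 𝕜 n).val.toRingHom).codRestrict
    (ConvergentSeries 𝕜' n) fun a => IsConvergentSeries.of_norm_coeff_le a.2 fun _ => hφ _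

/-- The inclusion `ℝ{x} → ℂ{x}`. -/
noncomputable def complexify : ConvergentSeries ℝ n →+* ConvergentSeries ℂ n :=
  mapCoeff Complex.ofRealHom fun x => (Complex.norm_real x).le

/-- Complex conjugation of the coefficients of a series. -/
noncomputable def conj : ConvergentSeries ℂ n →+* ConvergentSeries ℂ n :=
  mapCoeff (starRingEnd ℂ) fun z => (Complex.norm_conj z).le

/-- The real part of a series: that of each of its coefficients. -/
noncomputable def rePart (s : ConvergentSeries ℂ n) : ConvergentSeries ℝ n :=
  ⟨fun ν => (MvPowerSeries.coeff ν s.1).re,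
    IsConvergentSeries.of_norm_coeff_le s.2 fun _ => Complex.abs_re_le_norm _⟩

/-- The imaginary part of a series: that of each of its coefficients. -/
noncomputable def imPart (s : ConvergentSeries ℂ n) : ConvergentSeries ℝ n :=
  ⟨fun ν => (MvPowerSeries.coeff ν s.1).im,
    IsConvergentSeries.of_norm_coeff_le s.2 fun _ => Complex.abs_im_le_norm _⟩

theorem ext_coeff {𝕜 : Type*} [NormedField 𝕜] {a b : ConvergentSeries 𝕜 n}
    (h : ∀ ν, MvPowerSeries.coeff ν a.1 = MvPowerSeries.coeff ν b.1) : a = b :=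
  Subtype.ext (MvPowerSeries.ext h)

theorem coeff_smul {𝕜 : Type*} [NormedField 𝕜] (c : 𝕜) (a : ConvergentSeries 𝕜 n)
    (ν : Fin n →₀ ℕ) : MvPowerSeries.coeff ν (c • a).1 = c * MvPowerSeries.coeff ν a.1 := rfl

theorem coeff_complexify (a : ConvergentSeries ℝ n) (ν : Fin n →₀ ℕ) :
    MvPowerSeries.coeff ν (complexify a).1 = ((MvPowerSeries.coeff ν a.1 : ℝ) : ℂ) := rfl

theorem coeff_conj (s : ConvergentSeries ℂ n) (ν : Fin n →₀ ℕ) :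
    MvPowerSeries.coeff ν (conj s).1 = starRingEnd ℂ (MvPowerSeries.coeff ν s.1) := rfl

theorem coeff_rePart (s : ConvergentSeries ℂ n) (ν : Fin n →₀ ℕ) :
    MvPowerSeries.coeff ν (rePart s).1 = (MvPowerSeries.coeff ν s.1).re := rfl

theorem coeff_imPart (s : ConvergentSeries ℂ n) (ν : Fin n →₀ ℕ) :
    MvPowerSeries.coeff ν (imPart s).1 = (MvPowerSeries.coeff ν s.1).im := rfl

theorem complexify_injective :
    Function.Injective (complexify : ConvergentSeries ℝ n →+* ConvergentSeries ℂ n) := by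
  intro a b h
  refine ext_coeff fun ν => Complex.ofReal_injective ?_
  rw [← coeff_complexify, ← coeff_complexify, h]

theorem complexify_smul (c : ℝ) (a : ConvergentSeries ℝ n) :
    complexify (c • a) = (c : ℂ) • complexify a :=
  ext_coeff fun ν => by
    rw [coeff_complexify, coeff_smul, coeff_smul, coeff_complexify, Complex.ofReal_mul]

theorem pderiv_complexify (i : Fin n) (a : ConvergentSeries ℝ n) :
    pderiv i (complexify a) = complexify (pderiv i a) :=
  ext_coeff fun ν => by
    simp only [pderiv, coeff_complexify, MvPowerSeries.coeff_pderiv]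
    push_cast
    rfl

theorem conj_complexify (a : ConvergentSeries ℝ n) : conj (complexify a) = complexify a :=
  ext_coeff fun ν => by rw [coeff_conj, coeff_complexify, Complex.conj_ofReal]

theorem conj_smul (c : ℂ) (s : ConvergentSeries ℂ n) :
    conj (c • s) = starRingEnd ℂ c • conj s :=
  ext_coeff fun ν => by rw [coeff_conj, coeff_smul, coeff_smul, coeff_conj, map_mul]

theorem conj_complexify_sub_smul (f g : ConvergentSeries ℝ n) (c : ℂ) :
    conj (complexify f - c • complexify g) =
      complexify f - starRingEnd ℂ c • complexify g := by
  rw [map_sub, conj_smul, conj_complexify, conj_complexify]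

theorem rePart_complexify_mul (a : ConvergentSeries ℝ n) (s : ConvergentSeries ℂ n) :
    rePart (complexify a * s) = a * rePart s := by
  classical
  exact ext_coeff fun ν => by
    simp only [coeff_rePart, MulMemClass.coe_mul, MvPowerSeries.coeff_mul, Complex.re_sum,
      coeff_complexify, Complex.re_ofReal_mul]

theorem complexify_dvd_complexify_iff {a b : ConvergentSeries ℝ n} :
    complexify a ∣ complexify b ↔ a ∣ b := by
  refine ⟨fun ⟨s, hs⟩ => ⟨rePart s, ?_⟩, map_dvd complexify⟩
  rw [← rePart_complexify_mul, ← hs]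
  rfl

instance isLocalHom_complexify :
    IsLocalHom (complexify : ConvergentSeries ℝ n →+* ConvergentSeries ℂ n) where
  map_nonunit a ha := by
    rwa [isUnit_iff_dvd_one, ← map_one complexify, complexify_dvd_complexify_iff,
      ← isUnit_iff_dvd_one] at ha

theorem complexify_rePart_add (s : ConvergentSeries ℂ n) :
    complexify (rePart s) + Complex.I • complexify (imPart s) = s :=
  ext_coeff fun _ => (congrArg _ (mul_comm _ _)).trans (Complex.re_add_im _)

theorem mul_conj (s : ConvergentSeries ℂ n) :
    s * conj s = complexify (rePart s ^ 2 + imPart s ^ 2) := by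
  have I_sq : algebraMap ℂ (ConvergentSeries ℂ n) Complex.I ^ 2 = -1 := by
    rw [← map_pow, Complex.I_sq, map_neg, map_one]
  conv_lhs => rw [← complexify_rePart_add s]
  rw [map_add, conj_smul, conj_complexify, conj_complexify, Complex.conj_I, map_add, map_pow,
    map_pow, Algebra.smul_def, Algebra.smul_def, map_neg]
  linear_combination (-complexify (imPart s) ^ 2) * I_sq

/-- The norm `s s̄` from `ℂ{x}` to `ℝ{x}`. -/
noncomputable def normSq : ConvergentSeries ℂ n →* ConvergentSeries ℝ n where
  toFun s := rePart s ^ 2 + imPart s ^ 2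
  map_one' := complexify_injective (by rw [← mul_conj, map_one, map_one, mul_one])
  map_mul' s t := complexify_injective (by
    rw [map_mul, ← mul_conj, ← mul_conj, ← mul_conj, map_mul, mul_mul_mul_comm])

theorem normSq_apply (s : ConvergentSeries ℂ n) : normSq s = rePart s ^ 2 + imPart s ^ 2 := rfl

theorem complexify_normSq (s : ConvergentSeries ℂ n) : complexify (normSq s) = s * conj s :=
  (mul_conj s).symm

theorem normSq_complexify (a : ConvergentSeries ℝ n) : normSq (complexify a) = a ^ 2 :=
  complexify_injective (by rw [complexify_normSq, conj_complexify, map_pow, sq])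

theorem exists_normSq_eq (a b : ConvergentSeries ℝ n) : ∃ s, normSq s = a ^ 2 + b ^ 2 := by
  refine ⟨complexify a + Complex.I • complexify b, ?_⟩
  rw [normSq_apply]
  congr 2
  · exact ext_coeff fun ν => by simp [coeff_rePart, coeff_complexify]
  · exact ext_coeff fun ν => by simp [coeff_imPart, coeff_complexify]

theorem normSq_complexify_sub_smul (f g : ConvergentSeries ℝ n) (c : ℂ) :
    normSq (complexify f - c • complexify g) =
      f ^ 2 + (‖c‖ ^ 2) • g ^ 2 - (2 * c.re) • (f * g) := by
  have rePart_eq : rePart (complexify f - c • complexify g) = f - c.re • g :=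
    ext_coeff fun ν => by simp [coeff_rePart, coeff_complexify]
  have imPart_eq : imPart (complexify f - c • complexify g) = -(c.im • g) :=
    ext_coeff fun ν => by simp [coeff_imPart, coeff_complexify]
  rw [normSq_apply, rePart_eq, imPart_eq, Complex.sq_norm, Complex.normSq_apply]
  simp only [Algebra.smul_def, map_add, map_mul, map_ofNat]
  ring

instance isLocalHom_normSq :
    IsLocalHom (normSq : ConvergentSeries ℂ n →* ConvergentSeries ℝ n) where
  map_nonunit s hs := by
    have hu := hs.map complexify
    rw [complexify_normSq] at hu
    exact isUnit_of_mul_isUnit_left hu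

theorem normSq_dvd_sq {s : ConvergentSeries ℂ n} {a : ConvergentSeries ℝ n}
    (h : s ∣ complexify a) : normSq s ∣ a ^ 2 := by
  rw [← normSq_complexify]
  exact map_dvd normSq h

theorem dvd_normSq {s : ConvergentSeries ℂ n} {h : ConvergentSeries ℝ n} (hh : Prime h)
    (hs : ¬ IsUnit s) (hd : s ∣ complexify h) : h ∣ normSq s := by
  obtain ⟨i, -, hi⟩ := (dvd_prime_pow hh 2).1 (normSq_dvd_sq hd)
  refine (dvd_pow_self h ?_).trans hi.symm.dvd
  rintro rfl
  rw [pow_zero, associated_one_iff_isUnit] at hi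
  exact hs (hi.of_map normSq)

theorem dvd_complexify_iff {s : ConvergentSeries ℂ n} {h b : ConvergentSeries ℝ n} (hh : Prime h)
    (hs : ¬ IsUnit s) (hd : s ∣ complexify h) : s ∣ complexify b ↔ h ∣ b :=
  ⟨fun hb => hh.dvd_of_dvd_pow ((dvd_normSq hh hs hd).trans (normSq_dvd_sq hb)),
    fun hb => hd.trans (map_dvd complexify hb)⟩

theorem dvd_complexify_of_dvd_of_dvd_conj {f g : ConvergentSeries ℝ n} {s : ConvergentSeries ℂ n}
    {c : ℂ} (hc : c.im ≠ 0) (hd : s ∣ complexify f - c • complexify g)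
    (hd' : s ∣ conj (complexify f - c • complexify g)) : s ∣ complexify g := by
  have sub_conj_ne : c - starRingEnd ℂ c ≠ 0 := by simp [Complex.sub_conj, hc]
  rw [conj_complexify_sub_smul] at hd'
  have dvd_smul := dvd_sub hd' hd
  rw [sub_sub_sub_cancel_left, ← sub_smul] at dvd_smul
  exact (dvd_smul_iff_of_ne_zero sub_conj_ne).1 dvd_smul

theorem normSq_pow_dvd {s : ConvergentSeries ℂ n} {a : ConvergentSeries ℝ n} {m : ℕ}
    (hs : Prime s) (hconj : ¬ s ∣ conj s) (hd : s ^ m ∣ complexify a) : normSq s ^ m ∣ a := by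
  obtain ⟨t, ht⟩ := map_dvd conj hd
  rw [conj_complexify, map_pow] at ht
  rw [← complexify_dvd_complexify_iff, map_pow, complexify_normSq, mul_pow, mul_comm, ht]
  rw [ht] at hd
  exact mul_dvd_mul_left _
    (hs.pow_dvd_of_dvd_mul_left m (fun h => hconj (hs.dvd_of_dvd_pow h)) hd)

theorem exists_associated_of_associated_normSq {s : ConvergentSeries ℂ n}
    {h : ConvergentSeries ℝ n} (hs : Associated (normSq s) h) :
    ∃ t, Associated s t ∧ (h = normSq t ∨ h = -normSq t) := by
  obtain ⟨v, rfl⟩ := hs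
  obtain ⟨w, hw⟩ := exists_eq_sq_or_eq_neg_sq v.isUnit
  have isUnit_w : IsUnit w := by
    have dvd_v : w ^ 2 ∣ v := hw.elim (fun h => h ▸ dvd_rfl) fun h => ⟨-1, by rw [h]; ring⟩
    exact (isUnit_pow_iff two_ne_zero).1 (isUnit_of_dvd_unit dvd_v v.isUnit)
  refine ⟨s * complexify w, associated_mul_unit_right _ _ (isUnit_w.map complexify), ?_⟩
  rw [map_mul, normSq_complexify]
  exact hw.imp (congrArg _) fun h => by rw [h]; ring

end ConvergentSeries

namespace ConvergentSeries

variable {n : ℕ} {f g h : ConvergentSeries ℝ n} {m : ℕ}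

theorem nonrealLevel_iff :
    NonrealLevel f g h m ↔ ∃ (c : ℂ) (s t : ConvergentSeries ℂ n), c.im ≠ 0 ∧
      (h = normSq s ∨ h = -normSq s) ∧
      normSq (complexify f - c • complexify g) = normSq s ^ (m + 1) * normSq t := by
  constructor
  · rintro ⟨c, ρ₁, ρ₂, ς₁, ς₂, hc, hρ, heq⟩
    obtain ⟨s, hs⟩ := exists_normSq_eq ρ₁ ρ₂
    obtain ⟨t, ht⟩ := exists_normSq_eq ς₁ ς₂
    refine ⟨c, s, t, hc, ?_, ?_⟩
    · rwa [hs]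
    · rw [normSq_complexify_sub_smul, heq, hs, ht]
  · rintro ⟨c, s, t, hc, hs, heq⟩
    rw [normSq_complexify_sub_smul] at heq
    exact ⟨c, rePart s, imPart s, rePart t, imPart t, hc, hs, heq⟩

theorem RealLevel.pow_dvd_wronskian (hfg : IsRelPrime f g) (hh : Prime h)
    (hl : RealLevel f g h m) :
    ¬ h ∣ f ∧ ¬ h ∣ g ∧ ∀ i, h ^ m ∣ g * pderiv i f - f * pderiv i g := by
  obtain ⟨c, s, hc, hs⟩ := hl
  have hd : h ^ (m + 1) ∣ f - c • g := ⟨s, hs⟩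
  have dvd_iff : h ∣ f ↔ h ∣ g :=
    dvd_iff_dvd_of_dvd_sub_smul hc ((dvd_pow_self h m.succ_ne_zero).trans hd)
  have not_dvd_f : ¬ h ∣ f := fun hf => hh.not_isUnit (hfg hf (dvd_iff.1 hf))
  refine ⟨not_dvd_f, mt dvd_iff.2 not_dvd_f,
    pow_dvd_wronskian_of_pow_succ_dvd_sub_smul hd⟩

theorem not_dvd_complexify_of_dvd_normSq (hfg : IsRelPrime f g) (hh : Prime h)
    {s : ConvergentSeries ℂ n} (hs : Prime s) (hsh : s ∣ complexify h) {c : ℂ}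
    (hd : s ∣ complexify (normSq (complexify f - c • complexify g))) : ¬ s ∣ complexify g := by
  intro hg
  rw [complexify_normSq, conj_complexify_sub_smul] at hd
  have hf : s ∣ complexify f := (hs.dvd_or_dvd hd).elim
    (fun h => (dvd_sub_left (dvd_smul_of_dvd _ hg)).1 h)
    fun h => (dvd_sub_left (dvd_smul_of_dvd _ hg)).1 h
  rw [dvd_complexify_iff hh hs.not_isUnit hsh] at hf hg
  exact hh.not_isUnit (hfg hf hg)

theorem exists_pow_dvd_sub_smul_of_pow_dvd_normSq {s : ConvergentSeries ℂ n} (hs : Prime s)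
    (hg : ¬ s ∣ complexify g) {c : ℂ} (hc : c.im ≠ 0)
    (hd : s ^ m ∣ complexify (normSq (complexify f - c • complexify g))) :
    ∃ c' : ℂ, c'.im ≠ 0 ∧ s ^ m ∣ complexify f - c' • complexify g := by
  rw [complexify_normSq] at hd
  by_cases hdvd : s ∣ complexify f - c • complexify g
  · exact ⟨c, hc, hs.pow_dvd_of_dvd_mul_right m
      (fun h => hg (dvd_complexify_of_dvd_of_dvd_conj hc hdvd h)) hd⟩
  · refine ⟨starRingEnd ℂ c, by simpa using hc, ?_⟩
    rw [← conj_complexify_sub_smul]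
    exact hs.pow_dvd_of_dvd_mul_left m hdvd hd

theorem normSq_pow_dvd_wronskian {s : ConvergentSeries ℂ n} (hs : Prime s)
    (hg : ¬ s ∣ complexify g) {c : ℂ} (hc : c.im ≠ 0)
    (hd : s ^ (m + 1) ∣ complexify f - c • complexify g) (i : Fin n) :
    normSq s ^ m ∣ g * pderiv i f - f * pderiv i g := by
  have hd1 := (dvd_pow_self s m.succ_ne_zero).trans hd
  refine normSq_pow_dvd hs
    (fun h => hg (dvd_complexify_of_dvd_of_dvd_conj hc hd1 (h.trans (map_dvd conj hd1)))) ?_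
  rw [map_sub, map_mul, map_mul, ← pderiv_complexify, ← pderiv_complexify]
  exact pow_dvd_wronskian_of_pow_succ_dvd_sub_smul hd i

theorem NonrealLevel.pow_dvd_wronskian (hfg : IsRelPrime f g) (hh : Prime h)
    (hl : NonrealLevel f g h m) :
    ¬ h ∣ f ∧ ¬ h ∣ g ∧ ∀ i, h ^ m ∣ g * pderiv i f - f * pderiv i g := by
  obtain ⟨c, s, t, hc, hhs, heq⟩ := nonrealLevel_iff.1 hl
  have associated : Associated h (normSq s) := by
    rcases hhs with rfl | rfl
    exacts [.refl _, (Associated.refl (normSq s)).neg_left]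
  have irreducible_norm : Irreducible (normSq s) := (associated.prime hh).irreducible
  have prime_s : Prime s := irreducible_norm.of_map.prime
  have dvd_norm : s ∣ complexify (normSq s) := ⟨conj s, complexify_normSq s⟩
  have dvd_h : s ∣ complexify h := dvd_norm.trans (map_dvd complexify associated.symm.dvd)
  have dvd_iff (b) : s ∣ complexify b ↔ h ∣ b := dvd_complexify_iff hh prime_s.not_isUnit dvd_h
  have pow_dvd : s ^ (m + 1) ∣ complexify (normSq (complexify f - c • complexify g)) := by
    rw [heq, map_mul, map_pow]
    exact (pow_dvd_pow_of_dvd dvd_norm _).mul_right _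
  have not_dvd_g : ¬ s ∣ complexify g := not_dvd_complexify_of_dvd_normSq hfg hh prime_s dvd_h
    ((dvd_pow_self s m.succ_ne_zero).trans pow_dvd)
  obtain ⟨c', hc', hd⟩ := exists_pow_dvd_sub_smul_of_pow_dvd_normSq prime_s not_dvd_g hc pow_dvd
  have c'_ne : c' ≠ 0 := fun h0 => hc' (by rw [h0, Complex.zero_im])
  have not_dvd_f : ¬ s ∣ complexify f := fun hf => not_dvd_g
    ((dvd_iff_dvd_of_dvd_sub_smul c'_ne ((dvd_pow_self s m.succ_ne_zero).trans hd)).1 hf)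
  exact ⟨mt (dvd_iff f).2 not_dvd_f, mt (dvd_iff g).2 not_dvd_g, fun i =>
    associated.pow_pow.dvd_iff_dvd_left.2 (normSq_pow_dvd_wronskian prime_s not_dvd_g hc' hd i)⟩

theorem realLevel_of_pow_dvd_wronskian (hh : Prime h) (hf : ¬ h ∣ f) (hg : ¬ h ∣ g) {c : ℝ}
    (hc : h ∣ f - c • g) (hd : ∀ i, h ^ m ∣ g * pderiv i f - f * pderiv i g) :
    RealLevel f g h m := by
  have c_ne : c ≠ 0 := by
    rintro rfl
    rw [zero_smul, sub_zero] at hc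
    exact hf hc
  obtain ⟨s, hs⟩ := pow_succ_dvd_sub_smul_of_pow_dvd_wronskian hh hg hc hd
  exact ⟨c, s, c_ne, hs⟩

theorem nonrealLevel_of_pow_dvd_wronskian (hh : Prime h) (hg : ¬ h ∣ g)
    {s : ConvergentSeries ℂ n} (hs : Prime s) (hsh : s ∣ complexify h) {c : ℂ} (hc : c.im ≠ 0)
    (hsc : s ∣ complexify f - c • complexify g)
    (hd : ∀ i, s ^ m ∣
      complexify g * pderiv i (complexify f) - complexify f * pderiv i (complexify g)) :
    NonrealLevel f g h m := by
  have not_dvd_g : ¬ s ∣ complexify g := mt (dvd_complexify_iff hh hs.not_isUnit hsh).1 hg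
  have not_dvd_conj : ¬ s ∣ conj s := fun h =>
    not_dvd_g (dvd_complexify_of_dvd_of_dvd_conj hc hsc (h.trans (map_dvd conj hsc)))
  have norm_dvd : normSq s ∣ h := by
    simpa only [pow_one] using normSq_pow_dvd (m := 1) hs not_dvd_conj (by rwa [pow_one])
  obtain ⟨t, hst, ht⟩ := exists_associated_of_associated_normSq
    (associated_of_dvd_dvd norm_dvd (dvd_normSq hh hs.not_isUnit hsh))
  obtain ⟨r, hr⟩ := hst.pow_pow.dvd_iff_dvd_left.1
    (pow_succ_dvd_sub_smul_of_pow_dvd_wronskian hs not_dvd_g hsc hd)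
  exact nonrealLevel_iff.2 ⟨c, t, r, hc, ht, by rw [hr, map_mul, map_pow]⟩

theorem level_of_pow_dvd_wronskian (hh : Prime h) (hf : ¬ h ∣ f) (hg : ¬ h ∣ g) (hm : m ≠ 0)
    (hd : ∀ i, h ^ m ∣ g * pderiv i f - f * pderiv i g) :
    RealLevel f g h m ∨ NonrealLevel f g h m := by
  obtain ⟨s, irreducible_s, hsh⟩ := WfDvdMonoid.exists_irreducible_factor (a := complexify h)
    (fun hu => hh.not_isUnit (hu.of_map complexify))
    ((map_ne_zero_iff complexify complexify_injective).2 hh.ne_zero)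
  have hs : Prime s := irreducible_s.prime
  have dvd_iff (b) : s ∣ complexify b ↔ h ∣ b := dvd_complexify_iff hh hs.not_isUnit hsh
  have pow_dvd (i) : s ^ m ∣
      complexify g * pderiv i (complexify f) - complexify f * pderiv i (complexify g) := by
    rw [pderiv_complexify, pderiv_complexify, ← map_mul, ← map_mul, ← map_sub]
    refine (pow_dvd_pow_of_dvd hsh m).trans ?_
    rw [← map_pow]
    exact map_dvd complexify (hd i)
  obtain ⟨c, hc⟩ := exists_dvd_sub_smul hs (mt (dvd_iff g).1 hg) fun i =>
    (dvd_pow_self s hm).trans (pow_dvd i)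
  by_cases hcim : c.im = 0
  · lift c to ℝ using hcim
    rw [← complexify_smul, ← map_sub, dvd_iff] at hc
    exact .inl (realLevel_of_pow_dvd_wronskian hh hf hg hc hd)
  · exact .inr (nonrealLevel_of_pow_dvd_wronskian hh hg hs hsh hcim hc pow_dvd)

theorem IrredDecomp.pow_dvd_theta_iff_level (F : IrredDecomp f) (G : IrredDecomp g)
    (hfg : IsRelPrime f g) (hh : Prime h) (hm : m ≠ 0) :
    (∀ k, h ^ m ∣ F.theta G k) ↔ RealLevel f g h m ∨ NonrealLevel f g h m := by
  constructor
  · intro hd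
    obtain ⟨hf, hg⟩ := not_dvd_of_dvd_theta hfg hh fun k => (dvd_pow_self h hm).trans (hd k)
    exact level_of_pow_dvd_wronskian hh hf hg hm fun i => (pow_dvd_theta_iff hh hf hg m i).1 (hd i)
  · intro hl
    obtain ⟨hf, hg, hd⟩ :=
      hl.elim (fun hl => hl.pow_dvd_wronskian hfg hh) fun hl => hl.pow_dvd_wronskian hfg hh
    exact fun k => (pow_dvd_theta_iff hh hf hg m k).2 (hd k)

end ConvergentSeries

theorem mainTheorem3 {n : ℕ} (f g : ConvergentSeries ℝ n) (hfg : IsRelPrime f g)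
    (F : ConvergentSeries.IrredDecomp f) (G : ConvergentSeries.IrredDecomp g)
    (h : ConvergentSeries ℝ n) (hh : Irreducible h) (l : ℕ) (hl : 1 ≤ l) :
    ConvergentSeries.IsSingAlgComponent (F.theta G) h l ↔
      IsGreatest {m : ℕ | ConvergentSeries.RealLevel f g h m ∨
        ConvergentSeries.NonrealLevel f g h m} l := by
  have pow_dvd_iff (m : ℕ) (hm : 1 ≤ m) : (∀ k, h ^ m ∣ F.theta G k) ↔
      ConvergentSeries.RealLevel f g h m ∨ ConvergentSeries.NonrealLevel f g h m :=
    F.pow_dvd_theta_iff_level G hfg hh.prime (Nat.one_le_iff_ne_zero.1 hm)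
  rw [ConvergentSeries.isSingAlgComponent_iff, and_iff_right hh, and_iff_right hl]
  refine and_congr (pow_dvd_iff l hl) ⟨fun hmax m hm => ?_, fun hmax m hm => ?_⟩
  · obtain rfl | hm1 := m.eq_zero_or_pos
    exacts [l.zero_le, hmax ((pow_dvd_iff m hm1).2 hm)]
  · obtain rfl | hm1 := m.eq_zero_or_pos
    exacts [l.zero_le, hmax ((pow_dvd_iff m hm1).1 hm)]
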